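/- All graphs are finite and simple. A graph is outerplanar if it has an embedding in the plane (vertices are distinct points, edges are Jordan arcs that meet only at common end-vertices) such that all vertices lie on the boundary of a single face. A tree covering of a graph $G$ is a family of pairwise vertex-disjoint induced subgraphs of $G$, each of which is a tree, that together contain all vertices of $G$. The tree cover number $T(G)$ is the minimum number of trees in a tree covering of $G$, and a tree covering with $T(G)$ trees is called minimum. Let $B$ be the set of black vertices of $G$, all other vertices being white. The positive colour change rule says that $u\in B$ can force (turn black) a white vertex $w$ if, for some connected component $W$ of $G\setminus B$, the vertex $w$ is the only neighbour of $u$ in $W$. A positive zero forcing process consists of an initial set $Z$ of black vertices and a chronological list of such forces, each applied to the set of black vertices at that moment, after which all vertices are black; then $Z$ is called a positive zero forcing set. The positive zero forcing number $Z_+(G)$ is the minimum size of a positive zero forcing set. For each $r\in Z$, the forcing tree of the process with root $r$ has as vertices $r$ and all vertices reached from $r$ by a sequence of forces of the process, and as edges the pairs $\{u,w\}$ of such vertices for which $u$ forces $w$ in the process. Theorem. Let $G$ be an outerplanar graph. Then $$Z_+(G)=T(G).$$ Moreover, every minimum tree covering $\mathcal T$ of $G$ is exactly the collection of forcing trees of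 some positive zero forcing process whose initial set has $Z_+(G)$ vertices; in particular $|\mathcal T|=Z_+(G)$. -/

import Mathlib

open unitInterval

namespace SimpleGraph

universe u

variable {V : Type u}

/-! ### Outerplanar graphs -/

/-- A planar embedding of a graph, the plane being `ℂ`: the vertices are distinct points, every edge
is drawn as a Jordan arc joining the points of its two ends, no arc passes through a vertex in its
interior, and the arcs of two different edges can only meet in (common) vertices. -/
structure PlanarEmbedding (G : SimpleGraph V) where
  point : V → ℂ
  point_injective : Function.Injective point
  arc : G.edgeSet → C(I, ℂ)
  arc_injective : ∀ e, Function.Injective (arc e)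
  arc_ends : ∀ e, s(arc e 0, arc e 1) = Sym2.map point e
  arc_avoids : ∀ (e : G.edgeSet) (t : I) (v : V), arc e t = point v → t = 0 ∨ t = 1
  arc_meet : ∀ e e' : G.edgeSet, e ≠ e' →
    ∀ s t : I, arc e s = arc e' t → ∃ v, arc e s = point v

/-- The subset of the plane covered by the drawing: all vertices and all edges. -/
def PlanarEmbedding.drawing {G : SimpleGraph V} (φ : G.PlanarEmbedding) : Set ℂ :=
  Set.range φ.point ∪ ⋃ e, Set.range (φ.arc e)

/-- The faces are the connected components of the complement of the drawing. -/
def PlanarEmbedding.IsFace {G : SimpleGraph V} (φ : G.PlanarEmbedding) (F : Set ℂ) : Prop :=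
  ∃ p ∈ φ.drawingᶜ, F = connectedComponentIn φ.drawingᶜ p

/-- A graph is outerplanar if it has a planar embedding with a face that has all the vertices on
its boundary. -/
def IsOuterplanar (G : SimpleGraph V) : Prop :=
  ∃ φ : G.PlanarEmbedding, ∃ F : Set ℂ, φ.IsFace F ∧ ∀ v, φ.point v ∈ frontier F

/-! ### Tree coverings -/

/-- A tree covering: a family of vertex-disjoint induced subgraphs, each of them a tree, that
together contain all the vertices. -/
structure IsTreeCovering (G : SimpleGraph V) (T : Set G.Subgraph) : Prop where
  isInduced : ∀ H ∈ T, H.IsInduced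
  isTree : ∀ H ∈ T, H.coe.IsTree
  disjoint : T.PairwiseDisjoint Subgraph.verts
  cover : ⋃ H ∈ T, H.verts = Set.univ

/-- The tree cover number `T(G)` (for a finite graph). -/
noncomputable def treeCoverNumber (G : SimpleGraph V) : ℕ :=
  sInf {k | ∃ T : Set G.Subgraph, G.IsTreeCovering T ∧ T.ncard = k}

/-! ### Positive zero forcing -/

/-- The positive colour change rule: if `B` is the set of black vertices, then `u` can force `w`
when `u` is black and, for some connected component `W` of `G \ B`, the vertex `w` is the only
neighbour of `u` in `W`. -/
def PositiveForces (G : SimpleGraph V) (B : Set V) (u w : V) : Prop :=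
  u ∈ B ∧ ∃ W : (G.induce Bᶜ).ConnectedComponent,
    {x | G.Adj u x ∧ ∃ hx : x ∈ Bᶜ, (G.induce Bᶜ).connectedComponentMk ⟨x, hx⟩ = W} = {w}

/-- `G.PositiveForcing B L C`: starting from the set `B` of black vertices, the forces in the
chronological list `L` (a pair `(u, w)` means that `u` forces `w`) can be performed one after the
other, and the set of black vertices is then `C`. -/
inductive PositiveForcing (G : SimpleGraph V) : Set V → List (V × V) → Set V → Prop
  | nil (B : Set V) : PositiveForcing G B [] B
  | cons {B C : Set V} {u w : V} {L : List (V × V)} (h : G.PositiveForces B u w)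
      (hL : PositiveForcing G (insert w B) L C) : PositiveForcing G B ((u, w) :: L) C

/-- A set of vertices is a positive zero forcing set if some sequence of forces starting from it
turns all the vertices black. -/
def IsPositiveZeroForcingSet (G : SimpleGraph V) (B : Set V) : Prop :=
  ∃ L, G.PositiveForcing B L Set.univ

/-- The positive zero forcing number `Z₊(G)` (for a finite graph). -/
noncomputable def positiveZeroForcingNumber (G : SimpleGraph V) : ℕ :=
  sInf {k | ∃ B : Set V, G.IsPositiveZeroForcingSet B ∧ B.ncard = k}

/-- The forcing tree with root `r` for a chronological list of forces `L`: its vertices are those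
that are reached from `r` by a sequence of forces in `L`, and its edges are the forces between
these vertices. (The clause `G.Adj a b` is automatic for the forces of a process.) -/
def forcingTree (G : SimpleGraph V) (L : List (V × V)) (r : V) : G.Subgraph where
  verts := {v | Relation.ReflTransGen (fun a b => (a, b) ∈ L) r v}
  Adj a b := Relation.ReflTransGen (fun a b => (a, b) ∈ L) r a ∧
    Relation.ReflTransGen (fun a b => (a, b) ∈ L) r b ∧ G.Adj a b ∧ ((a, b) ∈ L ∨ (b, a) ∈ L)
  adj_sub h := h.2.2.1
  edge_vert h := h.1
  symm := ⟨fun _ _ h => ⟨h.2.1, h.1, h.2.2.1.symm, h.2.2.2.symm⟩⟩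

end SimpleGraph

namespace SimpleGraph

universe u

variable {V : Type u}

/-! ### Logarithms of quotients in the plane -/

/-! For every graph `T(G) ≤ Z₊(G)`: the forcing trees of a process cover the vertices and are
induced subgraphs. The latter rests on an invariant (in `PositiveForcing.mem_of_adj`): two different
black vertices of one tree never have neighbours in a common white component. The reverse inequality
and the second claim both follow from one statement, `IsTreeCovering.exists_positiveForcing`: every
tree covering, minimum or not, is the collection of forcing trees of a process with one initial
vertex in each tree.

Outerplanarity enters only through the absence of a K₄ model. A graph with an edge and without such
a model has a vertex `v` of degree one or two (`exists_isK4Model_of_two_lt_degree`); call its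
neighbours `u` and `w`, possibly equal. Trees become colour classes, and the induction is on the
number of non-isolated vertices. If `v` is a tree by itself, it is black from the start and its
edges can be deleted. Otherwise let `u` be in the tree of `v`; delete the edges at `v`, join `u` to
`w` and give `v` a colour of its own, which amounts to contracting `uv` in the tree. No K₄ model
arises, and a process for the new graph lifts to `G`: a force along the new edge is subdivided
through `v`, and if there is none, `u` forces `v` at the very end.

That an outerplanar graph has no K₄ model (`IsOuterplanar.not_isK4Model`) is shown with logarithms
instead of the Jordan curve theorem. A model yields three closed sets joining `a` to `b` and meeting
only there; off each of them `(z - a) / (z - b)` has a continuous logarithm, normalised at a point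
of the given face. Since that face reaches every vertex, any two of the logarithms agree on the
third set. The median of their imaginary parts is then a continuous argument of the quotient on the
plane without `a` and `b`, which is impossible because the quotient winds around `a`. -/

open Complex Set Filter Topology in
-- With `γ` running from `b` to `a` inside `K`, the quotients `(z - γ t) / (z - b)` deform the
-- constant 1 without vanishing off `K`. Lifting this homotopy through the covering `exp`, from the
-- logarithm 0 of 1, gives a logarithm at time 1; a constant then corrects its value at `p`.
theorem exists_log_of_joinedIn {K : Set ℂ} {a b p l : ℂ} (h : JoinedIn K a b) (hp : p ∉ K)
    (hl : exp l = (p - a) / (p - b)) :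
    ∃ f : ℂ → ℂ, ContinuousOn f Kᶜ ∧ (∀ z ∈ Kᶜ, exp (f z) = (z - a) / (z - b)) ∧ f p = l := by
  obtain ⟨γ, hγ⟩ := h.symm
  have hb : ∀ z : (Kᶜ : Set ℂ), (z : ℂ) - b ≠ 0 := fun z h0 =>
    z.2 (by have := hγ 0; rw [γ.source] at this; rwa [sub_eq_zero.1 h0])
  have hne : ∀ (t : I) (z : (Kᶜ : Set ℂ)), ((z : ℂ) - γ t) / (z - b) ≠ 0 := fun t z =>
    div_ne_zero (fun h0 => z.2 (by rw [sub_eq_zero.1 h0]; exact hγ t)) (hb z)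
  let H : C(I × (Kᶜ : Set ℂ), {z : ℂ // z ≠ 0}) :=
    ⟨fun x => ⟨((x.2 : ℂ) - γ x.1) / (x.2 - b), hne x.1 x.2⟩, by
      refine Continuous.subtype_mk ?_ _
      exact Continuous.div (by fun_prop) (by fun_prop) fun x => hb x.2⟩
  let f0 : C((Kᶜ : Set ℂ), ℂ) := ⟨fun _ => 0, continuous_const⟩
  have H0 : ∀ z, H (0, z) = (⟨exp (f0 z), exp_ne_zero _⟩ : {z : ℂ // z ≠ 0}) := fun z => by
    apply Subtype.ext
    simp [H, f0, div_self (hb z)]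
  let G := Complex.isCoveringMap_exp.liftHomotopy H f0 H0
  have hG : ∀ x, exp (G x) = ((x.2 : ℂ) - γ x.1) / (x.2 - b) := fun x => by
    have := congrFun (Complex.isCoveringMap_exp.liftHomotopy_lifts H f0 H0) x
    exact congrArg Subtype.val this
  have hpG : exp (G (1, ⟨p, hp⟩)) = exp l := by rw [hG, hl]; simp
  classical
  refine ⟨fun z => if hz : z ∈ Kᶜ then G (1, ⟨z, hz⟩) + (l - G (1, ⟨p, hp⟩)) else 0, ?_, ?_, ?_⟩
  · rw [continuousOn_iff_continuous_domRestrict]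
    have : Continuous fun z : (Kᶜ : Set ℂ) => G (1, z) + (l - G (1, ⟨p, hp⟩)) := by fun_prop
    convert this using 1
    ext z
    simp only [Set.domRestrict_apply]
    rw [dif_pos z.2]
  · intro z hz
    simp only [dif_pos hz]
    rw [exp_add, exp_sub, hpG, div_self (exp_ne_zero _), mul_one, hG]
    simp
  · simp only [dif_pos (show p ∈ Kᶜ from hp)]
    ring

open Complex Set Filter Topology in
-- The difference divided by `2πi` is continuous and integer valued, hence constant on a
-- preconnected set.
theorem eqOn_of_exp_eq {f g : ℂ → ℂ} {S : Set ℂ} (hS : IsPreconnected S)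
    (hf : ContinuousOn f S) (hg : ContinuousOn g S) (h : ∀ z ∈ S, exp (f z) = exp (g z))
    {p : ℂ} (hp : p ∈ S) (hfg : f p = g p) {z : ℂ} (hz : z ∈ S) : f z = g z := by
  have hpi : (2 * Real.pi * Complex.I : ℂ) ≠ 0 := by simp [Real.pi_ne_zero]
  have key : ∀ z ∈ S, ∃ n : ℤ, (f z - g z) / (2 * Real.pi * Complex.I) = n := fun z hz => by
    obtain ⟨n, hn⟩ := exp_eq_exp_iff_exists_int.1 (h z hz)
    exact ⟨n, by rw [hn]; field_simp; ring⟩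
  choose! n hn using key
  have hc : ContinuousOn (fun z => ((f z - g z) / (2 * Real.pi * Complex.I)).re) S :=
    Complex.continuous_re.comp_continuousOn ((hf.sub hg).div_const _)
  have hc' : ContinuousOn n S := by
    have : ContinuousOn (fun z => ((n z : ℤ) : ℝ)) S := hc.congr fun z hz => by
      simp only
      rw [hn z hz, intCast_re]
    exact (Int.isClosedEmbedding_coe_real.isInducing.continuousOn_iff).2 this
  have := hS.constant hc' hz hp
  have h0 : n p = 0 := by
    have := hn p hp
    rw [hfg] at this
    simpa using this.symm
  have h1 := hn z hz
  rw [this, h0, div_eq_iff hpi] at h1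
  simpa [sub_eq_zero] using h1

open Complex Set Filter Topology in
-- On the circle of radius `‖a - b‖ / 2` about `a`, the factor `(z - b) / (a - b)` stays in the slit
-- plane and has a principal logarithm. Adding it to `f` and subtracting `t * I` would give a
-- logarithm of a constant, yet one turn changes it by `-2πi`.
theorem not_exists_log {a b : ℂ} (hab : a ≠ b) (f : ℂ → ℂ) (hf : ContinuousOn f {a, b}ᶜ)
    (h : ∀ z ∈ ({a, b} : Set ℂ)ᶜ, exp (f z) = (z - a) / (z - b)) : False := by
  set r : ℝ := ‖a - b‖ / 2 with hr
  have hab' : a - b ≠ 0 := sub_ne_zero.2 hab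
  have hr0 : 0 < r := by have := norm_pos_iff.2 hab'; positivity
  have hrc : (r : ℂ) ≠ 0 := by exact_mod_cast hr0.ne'
  let c : ℝ → ℂ := fun t => a + r * exp (t * Complex.I)
  have hcc : Continuous c := by fun_prop
  have hn : ∀ t : ℝ, ‖(r : ℂ) * exp (t * Complex.I)‖ = r := fun t => by
    rw [norm_mul, norm_exp_ofReal_mul_I, mul_one, Complex.norm_real, Real.norm_of_nonneg hr0.le]
  have hslit : ∀ t, (c t - b) / (a - b) ∈ slitPlane := fun t => by
    have : (c t - b) / (a - b) = 1 + (r * exp (t * Complex.I)) / (a - b) := by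
      field_simp; simp only [c]; ring
    rw [this]
    apply mem_slitPlane_of_norm_lt_one
    rw [norm_div, hn, hr]
    have := norm_pos_iff.2 hab'
    rw [div_lt_one this]
    linarith
  have hmem : ∀ t, c t ∈ ({a, b} : Set ℂ)ᶜ := fun t => by
    rintro (h1 | h1)
    · have : (r : ℂ) * exp (t * Complex.I) = 0 := by simpa [c] using h1
      simp [hrc, exp_ne_zero] at this
    · have h2 := hslit t
      have h1' : c t = b := h1
      rw [h1'] at h2
      simp at h2
  let g : ℝ → ℂ := fun t => f (c t) + Complex.log ((c t - b) / (a - b)) - t * Complex.I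
  have hg : Continuous g := by
    refine Continuous.sub (Continuous.add ?_ ?_) (by fun_prop)
    · exact hf.comp_continuous hcc hmem
    · exact Continuous.clog (by fun_prop) hslit
  have hexp : ∀ t, exp (g t) = r / (a - b) := fun t => by
    have hb : c t - b ≠ 0 := fun h0 => hmem t (Or.inr (sub_eq_zero.1 h0))
    simp only [g]
    rw [exp_sub, exp_add, h _ (hmem t), exp_log (div_ne_zero hb hab')]
    have := exp_ne_zero (t * Complex.I)
    field_simp
    simp [c]
    ring
  have hpi : (2 * Real.pi * Complex.I : ℂ) ≠ 0 := by simp [Real.pi_ne_zero]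
  have key : ∀ t, ∃ n : ℤ, (g t - g 0) / (2 * Real.pi * Complex.I) = n := fun t => by
    obtain ⟨n, hn⟩ := exp_eq_exp_iff_exists_int.1 ((hexp t).trans (hexp 0).symm)
    exact ⟨n, by rw [hn]; field_simp; ring⟩
  choose n hn using key
  have hc : Continuous fun t => ((g t - g 0) / (2 * Real.pi * Complex.I)).re :=
    Complex.continuous_re.comp ((hg.sub continuous_const).div_const _)
  have hc' : Continuous n := by
    have : Continuous fun t => ((n t : ℤ) : ℝ) := hc.congr fun t => by rw [hn]; simp
    exact (Int.isClosedEmbedding_coe_real.isInducing.continuous_iff).2 this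
  have h1 := isPreconnected_univ.constant hc'.continuousOn (mem_univ (2 * Real.pi)) (mem_univ 0)
  have h2 := hn (2 * Real.pi)
  rw [h1, ← hn 0] at h2
  have h3 : c (2 * Real.pi) = c 0 := by simp [c]
  rw [div_left_inj' hpi] at h2
  simp only [g, h3] at h2
  simp [Real.pi_ne_zero] at h2

/-- The median of three real numbers. -/
noncomputable def median (x y z : ℝ) : ℝ := max (min x y) (min (max x y) z)

theorem median_mem (x y z : ℝ) : median x y z = x ∨ median x y z = y ∨ median x y z = z := by
  unfold median; grind

theorem median_left (x y : ℝ) : median x y y = y := by unfold median; grind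
theorem median_middle (x y : ℝ) : median y x y = y := by unfold median; grind
theorem median_right (x y : ℝ) : median y y x = y := by unfold median; grind

open Complex Set Filter Topology in
theorem eventually_eq_of_exp_eq {f g q : ℂ → ℂ} {K L : Set ℂ} (hK : IsClosed K) (hL : IsClosed L)
    (hf : ContinuousOn f Kᶜ) (hg : ContinuousOn g Lᶜ) (hfe : ∀ z ∈ Kᶜ, exp (f z) = q z)
    (hge : ∀ z ∈ Lᶜ, exp (g z) = q z) {z : ℂ} (hzK : z ∉ K) (hzL : z ∉ L) (h : f z = g z) :
    ∀ᶠ w in 𝓝 z, w ∉ K ∧ w ∉ L ∧ f w = g w := by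
  have hopen : IsOpen (Kᶜ ∩ Lᶜ) := hK.isOpen_compl.inter hL.isOpen_compl
  obtain ⟨ε, hε, hball⟩ := Metric.isOpen_iff.1 hopen z ⟨hzK, hzL⟩
  filter_upwards [Metric.ball_mem_nhds z hε] with w hw
  refine ⟨(hball hw).1, (hball hw).2, ?_⟩
  exact eqOn_of_exp_eq (convex_ball z ε).isPreconnected
    (hf.mono fun x hx => (hball hx).1) (hg.mono fun x hx => (hball hx).2)
    (fun x hx => (hfe x (hball hx).1).trans (hge x (hball hx).2).symm)
    (Metric.mem_ball_self hε) h hw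

open Complex Set Filter Topology in
-- Near a point of `A` other than `a`, `b`, the functions `g` and `h` coincide, so the median of the
-- three imaginary parts is theirs, whatever `f` does there; likewise on `B` and `C`. Thus the
-- median is continuous off `{a, b}`, and everywhere it is the imaginary part of some logarithm of
-- the quotient. The real part is forced to be `log ‖·‖`.
theorem not_exists_theta {a b : ℂ} (hab : a ≠ b) {A B C : Set ℂ} (hA : IsClosed A)
    (hB : IsClosed B) (hC : IsClosed C) {f g h : ℂ → ℂ} (hf : ContinuousOn f Aᶜ)
    (hg : ContinuousOn g Bᶜ) (hh : ContinuousOn h Cᶜ)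
    (hfe : ∀ z ∈ Aᶜ, exp (f z) = (z - a) / (z - b))
    (hge : ∀ z ∈ Bᶜ, exp (g z) = (z - a) / (z - b))
    (hhe : ∀ z ∈ Cᶜ, exp (h z) = (z - a) / (z - b))
    (hAB : A ∩ B ⊆ {a, b}) (hAC : A ∩ C ⊆ {a, b}) (hBC : B ∩ C ⊆ {a, b})
    (hgh : ∀ z ∈ A, z ∉ ({a, b} : Set ℂ) → g z = h z)
    (hfh : ∀ z ∈ B, z ∉ ({a, b} : Set ℂ) → f z = h z)
    (hfg : ∀ z ∈ C, z ∉ ({a, b} : Set ℂ) → f z = g z) : False := by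
  have himc : ∀ {u : ℂ → ℂ} {K : Set ℂ} {z : ℂ}, IsClosed K → ContinuousOn u Kᶜ → z ∉ K →
      ContinuousAt (fun w => (u w).im) z := fun hK hu hz =>
    Complex.continuous_im.continuousAt.comp (hu.continuousAt (hK.isOpen_compl.mem_nhds hz))
  let m : ℂ → ℝ := fun z => median (f z).im (g z).im (h z).im
  have key : ∀ z ∉ ({a, b} : Set ℂ), ContinuousAt m z ∧ ∃ w, exp w = (z - a) / (z - b) ∧
      m z = w.im := by
    intro z hz
    by_cases hzA : z ∈ A
    · have hzB : z ∉ B := fun h' => hz (hAB ⟨hzA, h'⟩)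
      have hzC : z ∉ C := fun h' => hz (hAC ⟨hzA, h'⟩)
      have he := eventually_eq_of_exp_eq hB hC hg hh hge hhe hzB hzC (hgh z hzA hz)
      refine ⟨(himc hB hg hzB).congr ?_, g z, hge z hzB, ?_⟩
      · filter_upwards [he] with w hw
        simp only [m, hw.2.2, median_left]
      · simp only [m, hgh z hzA hz, median_left]
    by_cases hzB : z ∈ B
    · have hzC : z ∉ C := fun h' => hz (hBC ⟨hzB, h'⟩)
      have he := eventually_eq_of_exp_eq hA hC hf hh hfe hhe hzA hzC (hfh z hzB hz)
      refine ⟨(himc hA hf hzA).congr ?_, f z, hfe z hzA, ?_⟩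
      · filter_upwards [he] with w hw
        simp only [m, hw.2.2, median_middle]
      · simp only [m, hfh z hzB hz, median_middle]
    by_cases hzC : z ∈ C
    · have he := eventually_eq_of_exp_eq hA hB hf hg hfe hge hzA hzB (hfg z hzC hz)
      refine ⟨(himc hA hf hzA).congr ?_, f z, hfe z hzA, ?_⟩
      · filter_upwards [he] with w hw
        simp only [m, hw.2.2, median_right]
      · simp only [m, hfg z hzC hz, median_right]
    · refine ⟨?_, ?_⟩
      · have h1 := himc hA hf hzA
        have h2 := himc hB hg hzB
        have h3 := himc hC hh hzC
        exact (h1.min h2).max ((h1.max h2).min h3)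
      · rcases median_mem (f z).im (g z).im (h z).im with h' | h' | h'
        exacts [⟨f z, hfe z hzA, h'⟩, ⟨g z, hge z hzB, h'⟩, ⟨h z, hhe z hzC, h'⟩]
  have hz1 : ∀ z ∉ ({a, b} : Set ℂ), (z - a) / (z - b) ≠ 0 := fun z hz =>
    div_ne_zero (fun h0 => hz (Or.inl (sub_eq_zero.1 h0))) fun h0 => hz (Or.inr (sub_eq_zero.1 h0))
  refine not_exists_log hab
    (fun z => (Real.log ‖(z - a) / (z - b)‖ : ℂ) + m z * Complex.I) ?_ ?_
  · intro z hz
    apply ContinuousAt.continuousWithinAt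
    refine ContinuousAt.add ?_ ?_
    · refine Complex.continuous_ofReal.continuousAt.comp ?_
      refine ContinuousAt.log ?_ (norm_ne_zero_iff.2 (hz1 z hz))
      refine ContinuousAt.norm (ContinuousAt.div (by fun_prop) (by fun_prop) ?_)
      exact fun h0 => hz (Or.inr (sub_eq_zero.1 h0))
    · exact (Complex.continuous_ofReal.continuousAt.comp (key z hz).1).mul continuousAt_const
  · intro z hz
    obtain ⟨w, hw, hmw⟩ := (key z hz).2
    have : (Real.log ‖(z - a) / (z - b)‖ : ℂ) + m z * Complex.I = w := by
      rw [← hw, norm_exp, Real.log_exp, hmw, re_add_im]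
    simp only [this, hw]

/-! ### Models of the complete graph on four vertices -/

/-- Any two vertices of `S` are joined by a path of `G` inside `S`. -/
def ConnectedOn (G : SimpleGraph V) (S : Set V) : Prop :=
  ∀ x ∈ S, ∀ y ∈ S, Relation.ReflTransGen (fun x y => G.Adj x y ∧ x ∈ S ∧ y ∈ S) x y

/-- A minor model of `K₄` in `G`: two vertices `a`, `b` joined through `Z`, and two adjacent
connected sets `X`, `Y` each of which is adjacent to both `a` and `b`. -/
structure IsK4Model (G : SimpleGraph V) (a b : V) (X Y Z : Set V) : Prop where
  ne : a ≠ b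
  left_mem : a ∈ Z
  right_mem : b ∈ Z
  disjoint_XY : ∀ v ∈ X, v ∉ Y
  disjoint_XZ : ∀ v ∈ X, v ∉ Z
  disjoint_YZ : ∀ v ∈ Y, v ∉ Z
  connX : G.ConnectedOn X
  connY : G.ConnectedOn Y
  connZ : G.ConnectedOn Z
  adj_aX : ∃ x ∈ X, G.Adj a x
  adj_bX : ∃ x ∈ X, G.Adj b x
  adj_aY : ∃ y ∈ Y, G.Adj a y
  adj_bY : ∃ y ∈ Y, G.Adj b y
  adj_XY : ∃ x ∈ X, ∃ y ∈ Y, G.Adj x y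

theorem ConnectedOn.union {G : SimpleGraph V} {S T : Set V} (hS : G.ConnectedOn S)
    (hT : G.ConnectedOn T) {x y : V} (hx : x ∈ S) (hy : y ∈ T) (h : G.Adj x y) :
    G.ConnectedOn (S ∪ T) := by
  have hS' : ∀ u ∈ S, ∀ v ∈ S,
      Relation.ReflTransGen (fun x y => G.Adj x y ∧ x ∈ S ∪ T ∧ y ∈ S ∪ T) u v := fun u hu v hv =>
    (hS u hu v hv).lift id fun _ _ h => ⟨h.1, Or.inl h.2.1, Or.inl h.2.2⟩
  have hT' : ∀ u ∈ T, ∀ v ∈ T,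
      Relation.ReflTransGen (fun x y => G.Adj x y ∧ x ∈ S ∪ T ∧ y ∈ S ∪ T) u v := fun u hu v hv =>
    (hT u hu v hv).lift id fun _ _ h => ⟨h.1, Or.inr h.2.1, Or.inr h.2.2⟩
  rintro u (hu | hu) v (hv | hv)
  · exact hS' u hu v hv
  · exact ((hS' u hu x hx).tail ⟨h, Or.inl hx, Or.inr hy⟩).trans (hT' y hy v hv)
  · exact ((hT' u hu y hy).tail ⟨h.symm, Or.inr hy, Or.inl hx⟩).trans (hS' x hx v hv)
  · exact hT' u hu v hv

theorem connectedOn_singleton (G : SimpleGraph V) (a : V) : G.ConnectedOn {a} := by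
  rintro x rfl y rfl
  exact .refl

/-! ### Parts of a drawing and logarithms in their complements -/

namespace PlanarEmbedding

variable {G : SimpleGraph V} (φ : G.PlanarEmbedding)

/-- The part of the drawing formed by the edges in `E`. -/
def draw (E : Set (Sym2 V)) : Set ℂ := {z | ∃ e : G.edgeSet, e.1 ∈ E ∧ z ∈ Set.range (φ.arc e)}

/-- The edges with both ends in `S`. -/
def edgesIn (S : Set V) : Set (Sym2 V) := {e | ∀ v ∈ e, v ∈ S}

theorem draw_subset_drawing (E : Set (Sym2 V)) : φ.draw E ⊆ φ.drawing := by
  rintro z ⟨e, -, hz⟩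
  exact Or.inr (Set.mem_iUnion.2 ⟨e, hz⟩)

theorem isClosed_draw [Finite V] (E : Set (Sym2 V)) : IsClosed (φ.draw E) := by
  have : φ.draw E = ⋃ e : {e : G.edgeSet // e.1 ∈ E}, Set.range (φ.arc e.1) := by
    ext z
    simp only [draw, Set.mem_ofPred_eq, Set.mem_iUnion, Subtype.exists, exists_prop]
  rw [this]
  exact isClosed_iUnion_of_finite fun e => (isCompact_range (φ.arc e.1).continuous).isClosed

theorem point_mem_arc {e : G.edgeSet} {v : V} :
    φ.point v ∈ Set.range (φ.arc e) ↔ v ∈ e.1 := by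
  have hends : ∀ z, z ∈ s(φ.arc e 0, φ.arc e 1) ↔ z ∈ Sym2.map φ.point e.1 := fun z => by
    rw [φ.arc_ends]
  constructor
  · rintro ⟨t, ht⟩
    have : φ.point v ∈ s(φ.arc e 0, φ.arc e 1) := by
      rcases φ.arc_avoids e t v ht with rfl | rfl <;> rw [← ht] <;> simp
    rw [hends, Sym2.mem_map] at this
    obtain ⟨w, hw, hwv⟩ := this
    exact φ.point_injective hwv ▸ hw
  · intro hv
    have : φ.point v ∈ s(φ.arc e 0, φ.arc e 1) := by
      rw [hends, Sym2.mem_map]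
      exact ⟨v, hv, rfl⟩
    rw [Sym2.mem_iff] at this
    rcases this with h | h
    exacts [⟨0, h.symm⟩, ⟨1, h.symm⟩]

theorem exists_subarc {e : G.edgeSet} {v : V} (hv : v ∈ e.1) {z : ℂ}
    (hz : z ∈ Set.range (φ.arc e)) (hzv : ∀ w, z ≠ φ.point w) :
    ∃ S : Set ℂ, IsPreconnected S ∧ φ.point v ∈ S ∧ z ∈ S ∧ S ⊆ Set.range (φ.arc e) ∧
      ∀ w, φ.point w ∈ S → w = v := by
  obtain ⟨t, rfl⟩ := hz
  obtain ⟨s, hs⟩ := φ.point_mem_arc.2 hv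
  have hends := φ.arc_ends e
  have hend : ∀ r, (r = 0 ∨ r = 1) → ∃ w, φ.arc e r = φ.point w := by
    intro r hr
    have : φ.arc e r ∈ Sym2.map φ.point e.1 := by
      rw [← hends]; rcases hr with rfl | rfl <;> simp
    obtain ⟨w, -, hw⟩ := Sym2.mem_map.1 this
    exact ⟨w, hw.symm⟩
  have ht0 : t ≠ 0 := fun h => by obtain ⟨w, hw⟩ := hend t (Or.inl h); exact hzv w hw
  have ht1 : t ≠ 1 := fun h => by obtain ⟨w, hw⟩ := hend t (Or.inr h); exact hzv w hw
  have hconn : IsPreconnected (φ.arc e '' Set.uIcc s t) :=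
    (Set.ordConnected_uIcc.isPreconnected).image _ (φ.arc e).continuous.continuousOn
  refine ⟨_, hconn, ⟨s, Set.left_mem_uIcc, hs⟩, ⟨t, Set.right_mem_uIcc, rfl⟩,
    Set.image_subset_range _ _, ?_⟩
  rintro w ⟨r, hr, hrw⟩
  suffices r = s by rw [this, hs] at hrw; exact (φ.point_injective hrw).symm
  rcases φ.arc_avoids e r w hrw with rfl | rfl <;> rcases φ.arc_avoids e s v hs with rfl | rfl
  · rfl
  · rw [Set.uIcc_of_ge unitInterval.le_one'] at hr
    exact absurd (le_antisymm hr.1 unitInterval.nonneg') ht0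
  · rw [Set.uIcc_of_le unitInterval.nonneg'] at hr
    exact absurd (le_antisymm unitInterval.le_one' hr.2) ht1
  · rfl

theorem joinedIn_draw {S : Set V} {u v : V} (h : G.Adj u v) (hu : u ∈ S) (hv : v ∈ S) :
    JoinedIn (φ.draw (edgesIn S)) (φ.point u) (φ.point v) := by
  let e : G.edgeSet := ⟨s(u, v), h⟩
  have he : e.1 ∈ edgesIn S := by
    intro w hw
    rcases Sym2.mem_iff.1 hw with rfl | rfl <;> assumption
  have hp : ∀ x y : ℂ, φ.arc e 0 = x → φ.arc e 1 = y → JoinedIn (φ.draw (edgesIn S)) x y :=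
    fun x y hx hy => ⟨⟨φ.arc e, hx, hy⟩, fun t => ⟨e, he, t, rfl⟩⟩
  have hends : s(φ.arc e 0, φ.arc e 1) = s(φ.point u, φ.point v) := φ.arc_ends e
  rcases Sym2.eq_iff.1 hends with h' | h'
  · exact hp _ _ h'.1 h'.2
  · exact (hp _ _ h'.1 h'.2).symm

theorem joinedIn_draw_of_connectedOn {S : Set V} (hS : G.ConnectedOn S) {u v : V} (hu : u ∈ S)
    (hv : v ∈ S) (huv : u ≠ v) : JoinedIn (φ.draw (edgesIn S)) (φ.point u) (φ.point v) := by
  have key : ∀ w, Relation.ReflTransGen (fun x y => G.Adj x y ∧ x ∈ S ∧ y ∈ S) u w →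
      u = w ∨ JoinedIn (φ.draw (edgesIn S)) (φ.point u) (φ.point w) := by
    intro w hw
    induction hw with
    | refl => exact Or.inl rfl
    | tail _ h ih =>
      refine Or.inr ?_
      have h1 := φ.joinedIn_draw h.1 h.2.1 h.2.2
      rcases ih with rfl | ih
      exacts [h1, ih.trans h1]
  exact (key v (hS u hu v hv)).resolve_left huv

variable {φ} in
open Complex in
-- The face `F`, the point of `v` in its closure, and the piece of the arc from `v` to `z` form a
-- connected set. It avoids the drawing of `E` because no edge of `E` ends at `v`, so agreement at
-- `p` carries over to `z`.
theorem eq_of_exp_eq {F : Set ℂ} (hF : IsPreconnected F)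
    (hFd : F ⊆ φ.drawingᶜ) (hcl : ∀ v, φ.point v ∈ closure F) {E : Set (Sym2 V)} {f g : ℂ → ℂ}
    (hf : ContinuousOn f (φ.draw E)ᶜ) (hg : ContinuousOn g (φ.draw E)ᶜ)
    (h : ∀ z ∈ (φ.draw E)ᶜ, exp (f z) = exp (g z)) {p : ℂ} (hp : p ∈ F) (hfg : f p = g p)
    {v : V} (hv : ∀ e ∈ G.edgeSet, e ∈ E → v ∉ e) {e : G.edgeSet} (hve : v ∈ e.1) {z : ℂ}
    (hz : z ∈ Set.range (φ.arc e)) (hzv : ∀ w, z = φ.point w → w = v) : f z = g z := by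
  have hFE : F ⊆ (φ.draw E)ᶜ := hFd.trans (Set.compl_subset_compl.2 (φ.draw_subset_drawing E))
  have hvE : φ.point v ∉ φ.draw E := by
    rintro ⟨e', he', hv'⟩
    exact hv e'.1 e'.2 he' (φ.point_mem_arc.1 hv')
  have hins : IsPreconnected (insert (φ.point v) F) :=
    hF.subset_closure (Set.subset_insert _ _) (Set.insert_subset (hcl v) subset_closure)
  by_cases hzz : ∃ w, z = φ.point w
  · obtain ⟨w, rfl⟩ := hzz
    obtain rfl := hzv w rfl
    have hsub : insert (φ.point w) F ⊆ (φ.draw E)ᶜ := Set.insert_subset hvE hFE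
    exact eqOn_of_exp_eq hins (hf.mono hsub) (hg.mono hsub) (fun z hz => h z (hsub hz))
      (Set.mem_insert_of_mem _ hp) hfg (Set.mem_insert _ _)
  · obtain ⟨S, hS, hvS, hzS, hSe, hSv⟩ := φ.exists_subarc hve hz fun w hw => hzz ⟨w, hw⟩
    have hSE : S ⊆ (φ.draw E)ᶜ := by
      rintro x hx ⟨e', he', t', ht'⟩
      obtain ⟨t, ht⟩ := hSe hx
      by_cases hee : e = e'
      · subst hee; exact hv e.1 e.2 he' hve
      · obtain ⟨w, hw⟩ := φ.arc_meet e e' hee t t' (ht.trans ht'.symm)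
        rw [ht] at hw
        obtain rfl := hSv w (hw ▸ hx)
        exact hvE (hw ▸ ⟨e', he', t', ht'⟩)
    have hsub : insert (φ.point v) F ∪ S ⊆ (φ.draw E)ᶜ :=
      Set.union_subset (Set.insert_subset hvE hFE) hSE
    exact eqOn_of_exp_eq (hins.union (φ.point v) (Set.mem_insert _ _) hvS hS)
      (hf.mono hsub) (hg.mono hsub) (fun z hz => h z (hsub hz))
      (Or.inl (Set.mem_insert_of_mem _ hp)) hfg (Or.inr hzS)

end PlanarEmbedding

open PlanarEmbedding Complex in
-- The three sets for `not_exists_theta` are the drawings of the connections from `a` to `b` through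
-- `X`, through `Y` and within `Z`. The adjacency of `X` and `Y` is needed only for points of the
-- edge `ab`.
theorem IsOuterplanar.not_isK4Model [Finite V] {G : SimpleGraph V} (hG : G.IsOuterplanar) {a b : V}
    {X Y Z : Set V} (h : G.IsK4Model a b X Y Z) : False := by
  obtain ⟨φ, F, ⟨p, hp, hFp⟩, hfr⟩ := hG
  have hF : IsPreconnected F := hFp ▸ isPreconnected_connectedComponentIn
  have hFd : F ⊆ φ.drawingᶜ := hFp ▸ connectedComponentIn_subset _ _
  have hpF : p ∈ F := hFp ▸ mem_connectedComponentIn hp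
  have hcl : ∀ v, φ.point v ∈ closure F := fun v => frontier_subset_closure (hfr v)
  have hpd : ∀ E, p ∉ φ.draw E := fun E h' => hp (φ.draw_subset_drawing E h')
  have hpv : ∀ v, p - φ.point v ≠ 0 := fun v h' => hp (Or.inl ⟨v, (sub_eq_zero.1 h').symm⟩)
  -- Fixing one logarithm of `p - φ.point v` for each vertex makes the normalisations at `p` add up
  -- when quotients telescope.
  choose l hl using fun v => (⟨_, exp_log (hpv v)⟩ : ∃ l, exp l = p - φ.point v)
  have hlog : ∀ {S : Set V} {u v : V}, G.ConnectedOn S → u ∈ S → v ∈ S → u ≠ v →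
      ∃ f : ℂ → ℂ, ContinuousOn f (φ.draw (edgesIn S))ᶜ ∧
        (∀ z ∈ (φ.draw (edgesIn S))ᶜ, exp (f z) = (z - φ.point u) / (z - φ.point v)) ∧
        f p = l u - l v := fun hS hu hv huv =>
    exists_log_of_joinedIn (φ.joinedIn_draw_of_connectedOn hS hu hv huv) (hpd _)
      (by rw [exp_sub, hl, hl])
  obtain ⟨xa, hxa, haxa⟩ := h.adj_aX
  obtain ⟨xb, hxb, hbxb⟩ := h.adj_bX
  obtain ⟨ya, hya, haya⟩ := h.adj_aY
  obtain ⟨yb, hyb, hbyb⟩ := h.adj_bY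
  obtain ⟨x, hx, y, hy, hxy⟩ := h.adj_XY
  have haX : a ∉ X := fun h' => h.disjoint_XZ a h' h.left_mem
  have hbX : b ∉ X := fun h' => h.disjoint_XZ b h' h.right_mem
  have haY : a ∉ Y := fun h' => h.disjoint_YZ a h' h.left_mem
  have hbY : b ∉ Y := fun h' => h.disjoint_YZ b h' h.right_mem
  -- The logarithm through `X` is assembled from a piece from `a` to `x` and a piece from `x` to
  -- `b`. Its cut then consists of edges within `{a} ∪ X` or within `X ∪ {b}`, so it never contains
  -- the edge `ab`.
  obtain ⟨fax, cax, eax, pax⟩ := hlog ((G.connectedOn_singleton a).union h.connX rfl hxa haxa)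
    (Or.inl rfl) (Or.inr hx) (fun h' => haX (h' ▸ hx))
  obtain ⟨fxb, cxb, exb, pxb⟩ := hlog (h.connX.union (G.connectedOn_singleton b) hxb rfl hbxb.symm)
    (Or.inl hx) (Or.inr rfl) (fun h' => hbX (h' ▸ hx))
  obtain ⟨fay, cay, eay, pay⟩ := hlog ((G.connectedOn_singleton a).union h.connY rfl hya haya)
    (Or.inl rfl) (Or.inr hy) (fun h' => haY (h' ▸ hy))
  obtain ⟨fyb, cyb, eyb, pyb⟩ := hlog (h.connY.union (G.connectedOn_singleton b) hyb rfl hbyb.symm)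
    (Or.inl hy) (Or.inr rfl) (fun h' => hbY (h' ▸ hy))
  obtain ⟨fxy, cxy, exy, pxy⟩ := hlog (h.connX.union h.connY hx hy hxy)
    (Or.inl hx) (Or.inr hy) (fun h' => h.disjoint_XY _ hx (h' ▸ hy))
  obtain ⟨fz, cz, ez, pz⟩ := hlog h.connZ h.left_mem h.right_mem h.ne
  -- quotients telescope away from the vertices
  have htel : ∀ {S T : Set V} {s t r : V} {f g : ℂ → ℂ} {z : ℂ}, G.ConnectedOn S → s ∈ S → t ∈ S →
      s ≠ t →
      (∀ z ∈ (φ.draw (edgesIn S))ᶜ, exp (f z) = (z - φ.point s) / (z - φ.point t)) →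
      (∀ z ∈ (φ.draw (edgesIn T))ᶜ, exp (g z) = (z - φ.point t) / (z - φ.point r)) →
      z ∉ φ.draw (edgesIn S) → z ∉ φ.draw (edgesIn T) →
      exp (f z + g z) = (z - φ.point s) / (z - φ.point r) := by
    intro S T s t r f g z hS hs ht hst hf hg hzS hzT
    have : z - φ.point t ≠ 0 := fun h0 => hzS (by
      rw [sub_eq_zero.1 h0]
      exact (φ.joinedIn_draw_of_connectedOn hS hs ht hst).target_mem)
    rw [exp_add, hf z hzS, hg z hzT, div_mul_div_cancel₀ this]
  have hpick : ∀ {S : Set V} {e : G.edgeSet} {z : ℂ}, (∀ v ∈ e.1, v ∈ S ∨ v = a ∨ v = b) →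
      (∃ v ∈ e.1, v ∈ S) → z ∈ Set.range (φ.arc e) → z ∉ ({φ.point a, φ.point b} : Set ℂ) →
      ∃ v ∈ S, v ∈ e.1 ∧ ∀ w, z = φ.point w → w = v := by
    intro S e z he ⟨v, hv, hvS⟩ hz hzab
    by_cases hw : ∃ w, z = φ.point w
    · obtain ⟨w, rfl⟩ := hw
      have hwe := φ.point_mem_arc.1 hz
      refine ⟨w, ?_, hwe, fun w' hw' => (φ.point_injective hw').symm⟩
      rcases he w hwe with h' | rfl | rfl
      · exact h'
      · simp at hzab
      · simp at hzab
    · exact ⟨v, hvS, hv, fun w hw' => absurd ⟨w, hw'⟩ hw⟩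
  have hmeet : ∀ {S : Set V} {c : V} {e : G.edgeSet}, (∀ v ∈ e.1, v ∈ S ∨ v = c) →
      ∃ v ∈ e.1, v ∈ S := by
    rintro S c ⟨⟨u, v⟩, he⟩ hc
    by_contra! hcon
    have hu := (hc u (Sym2.mem_mk_left u v)).resolve_left (hcon u (Sym2.mem_mk_left u v))
    have hv := (hc v (Sym2.mem_mk_right u v)).resolve_left (hcon v (Sym2.mem_mk_right u v))
    exact G.ne_of_adj he (hu.trans hv.symm)
  have hdraw : ∀ {S : Set V} {z : ℂ},
      z ∈ φ.draw (edgesIn ({a} ∪ S) ∪ edgesIn (S ∪ {b})) →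
      ∃ e : G.edgeSet, z ∈ Set.range (φ.arc e) ∧ (∀ v ∈ e.1, v ∈ S ∨ v = a ∨ v = b) ∧
        ∃ v ∈ e.1, v ∈ S := by
    rintro S z ⟨e, he | he, hz⟩
    · exact ⟨e, hz, fun v hv => (he v hv).symm.imp_right Or.inl,
        hmeet fun v hv => (he v hv).symm⟩
    · exact ⟨e, hz, fun v hv => (he v hv).imp_right Or.inr, hmeet fun v hv => he v hv⟩
  have hEA : ∀ {S : Set V} {e : Sym2 V} {v : V},
      e ∈ edgesIn ({a} ∪ S) ∪ edgesIn (S ∪ {b}) → v ∈ e → v ∈ S ∨ v = a ∨ v = b := by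
    rintro S e v (he | he) hv
    · exact (he v hv).symm.imp_right Or.inl
    · exact (he v hv).imp_right Or.inr
  have hdisj : ∀ {S T : Set V} {E : Set (Sym2 V)}, (∀ v ∈ S, v ∉ T) → (∀ v ∈ S, v ≠ a ∧ v ≠ b) →
      (∀ e ∈ E, ∀ v ∈ e, v ∈ T ∨ v = a ∨ v = b) →
      φ.draw (edgesIn ({a} ∪ S) ∪ edgesIn (S ∪ {b})) ∩ φ.draw E ⊆ {φ.point a, φ.point b} := by
    rintro S T E hST hSab hE z ⟨hz, hz'⟩
    by_contra hzab
    obtain ⟨e, hze, he, hev⟩ := hdraw hz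
    obtain ⟨v, hvS, hve, hv⟩ := hpick he hev hze hzab
    have hvE : ∀ e ∈ E, v ∉ e := fun e' he' hv' => by
      rcases hE e' he' v hv' with h' | h' | h'
      exacts [hST v hvS h', (hSab v hvS).1 h', (hSab v hvS).2 h']
    obtain ⟨e', he', t', ht'⟩ := hz'
    obtain ⟨t, ht⟩ := hze
    by_cases hee : e = e'
    · subst hee; exact hvE _ he' hve
    · obtain ⟨w, hw⟩ := φ.arc_meet e e' hee t t' (ht.trans ht'.symm)
      obtain rfl := hv w (ht.symm.trans hw)
      exact hvE _ he' (φ.point_mem_arc.1 ⟨t', ht'.trans (ht.symm.trans hw)⟩)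
  have hXab : ∀ v ∈ X, v ≠ a ∧ v ≠ b := fun v hv =>
    ⟨fun h' => haX (h' ▸ hv), fun h' => hbX (h' ▸ hv)⟩
  have hYab : ∀ v ∈ Y, v ≠ a ∧ v ≠ b := fun v hv =>
    ⟨fun h' => haY (h' ▸ hv), fun h' => hbY (h' ▸ hv)⟩
  have hCE : ∀ e ∈ edgesIn Z, ∀ v ∈ e, v ∈ Z ∨ v = a ∨ v = b := fun e he v hv => Or.inl (he v hv)
  have hl1 : ∀ {E E' : Set (Sym2 V)} {f : ℂ → ℂ}, ContinuousOn f (φ.draw E)ᶜ → E ⊆ E' →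
      ContinuousOn f (φ.draw E')ᶜ := fun hf hE =>
    hf.mono (Set.compl_subset_compl.2 fun z ⟨e, he, hz⟩ => ⟨e, hE he, hz⟩)
  have hl2 : ∀ {E E' : Set (Sym2 V)} {z : ℂ}, z ∉ φ.draw E' → E ⊆ E' → z ∉ φ.draw E :=
    fun hz hE ⟨e, he, hz'⟩ => hz ⟨e, hE he, hz'⟩
  have cA : ContinuousOn (fax + fxb) (φ.draw (edgesIn ({a} ∪ X) ∪ edgesIn (X ∪ {b})))ᶜ :=
    (hl1 cax Set.subset_union_left).add (hl1 cxb Set.subset_union_right)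
  have cB : ContinuousOn (fay + fyb) (φ.draw (edgesIn ({a} ∪ Y) ∪ edgesIn (Y ∪ {b})))ᶜ :=
    (hl1 cay Set.subset_union_left).add (hl1 cyb Set.subset_union_right)
  have eA : ∀ z ∈ (φ.draw (edgesIn ({a} ∪ X) ∪ edgesIn (X ∪ {b})))ᶜ,
      exp ((fax + fxb) z) = (z - φ.point a) / (z - φ.point b) := fun z hz =>
    htel ((G.connectedOn_singleton a).union h.connX rfl hxa haxa) (Or.inl rfl) (Or.inr hx)
      (fun h' => haX (h' ▸ hx)) eax exb (hl2 hz Set.subset_union_left)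
      (hl2 hz Set.subset_union_right)
  have eB : ∀ z ∈ (φ.draw (edgesIn ({a} ∪ Y) ∪ edgesIn (Y ∪ {b})))ᶜ,
      exp ((fay + fyb) z) = (z - φ.point a) / (z - φ.point b) := fun z hz =>
    htel ((G.connectedOn_singleton a).union h.connY rfl hya haya) (Or.inl rfl) (Or.inr hy)
      (fun h' => haY (h' ▸ hy)) eay eyb (hl2 hz Set.subset_union_left)
      (hl2 hz Set.subset_union_right)
  have pA : (fax + fxb) p = l a - l b := by simp only [Pi.add_apply, pax, pxb]; ring
  have pB : (fay + fyb) p = l a - l b := by simp only [Pi.add_apply, pay, pyb]; ring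
  refine not_exists_theta (φ.point_injective.ne h.ne) (φ.isClosed_draw _) (φ.isClosed_draw _)
    (φ.isClosed_draw (edgesIn Z)) cA cB cz eA eB ez
    (hdisj h.disjoint_XY hXab fun e he v hv => hEA he hv)
    (hdisj h.disjoint_XZ hXab hCE) (hdisj h.disjoint_YZ hYab hCE) ?_ ?_ ?_
  -- A point of the cut through `X` lies on an edge at some vertex of `X`, which no edge of the
  -- other two cuts touches.
  · intro z hz hzab
    obtain ⟨e, hze, he, hev⟩ := hdraw hz
    obtain ⟨v, hvS, hve, hv⟩ := hpick he hev hze hzab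
    refine eq_of_exp_eq hF hFd hcl (hl1 cB Set.subset_union_left)
      (hl1 cz Set.subset_union_right) (fun z hz => ?_) hpF (pB.trans pz.symm) ?_ hve hze hv
    · rw [eB z (hl2 hz Set.subset_union_left), ez z (hl2 hz Set.subset_union_right)]
    · rintro e' - (he' | he') hv'
      · rcases hEA he' hv' with h' | h' | h'
        exacts [h.disjoint_XY v hvS h', (hXab v hvS).1 h', (hXab v hvS).2 h']
      · exact h.disjoint_XZ v hvS (he' v hv')
  · intro z hz hzab
    obtain ⟨e, hze, he, hev⟩ := hdraw hz
    obtain ⟨v, hvS, hve, hv⟩ := hpick he hev hze hzab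
    refine eq_of_exp_eq hF hFd hcl (hl1 cA Set.subset_union_left)
      (hl1 cz Set.subset_union_right) (fun z hz => ?_) hpF (pA.trans pz.symm) ?_ hve hze hv
    · rw [eA z (hl2 hz Set.subset_union_left), ez z (hl2 hz Set.subset_union_right)]
    · rintro e' - (he' | he') hv'
      · rcases hEA he' hv' with h' | h' | h'
        exacts [h.disjoint_XY v h' hvS, (hYab v hvS).1 h', (hYab v hvS).2 h']
      · exact h.disjoint_YZ v hvS (he' v hv')
  · rintro z ⟨e, he, hze⟩ hzab
    by_cases hev : ∃ v ∈ e.1, v ∈ Z \ {a, b}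
    · obtain ⟨v, hvS, hve, hv⟩ := hpick (S := Z \ {a, b}) (fun v hv => by
        have := he v hv
        by_cases h1 : v = a
        · exact Or.inr (Or.inl h1)
        by_cases h2 : v = b
        · exact Or.inr (Or.inr h2)
        exact Or.inl ⟨this, by simp [h1, h2]⟩) hev hze hzab
      refine eq_of_exp_eq hF hFd hcl (hl1 cA Set.subset_union_left)
        (hl1 cB Set.subset_union_right) (fun z hz => ?_) hpF (pA.trans pB.symm) ?_ hve hze hv
      · rw [eA z (hl2 hz Set.subset_union_left), eB z (hl2 hz Set.subset_union_right)]
      · rintro e' - (he' | he') hv' <;> rcases hEA he' hv' with h' | h' | h'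
        · exact h.disjoint_XZ v h' hvS.1
        · exact hvS.2 (Or.inl h')
        · exact hvS.2 (Or.inr h')
        · exact h.disjoint_YZ v h' hvS.1
        · exact hvS.2 (Or.inl h')
        · exact hvS.2 (Or.inr h')
    -- What remains is the edge `ab`, both of whose ends lie on the two cuts to be compared. The
    -- comparison is split by `fxy`: the drawings among `a`, `X`, `Y` avoid `b`, those among `b`,
    -- `X`, `Y` avoid `a`, and each half is compared through the end that it avoids.
    · have heab : ∀ v ∈ e.1, v = a ∨ v = b := fun v hv => by
        by_contra h'
        exact hev ⟨v, hv, he v hv, h'⟩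
      have hzw : ∀ w v, z = φ.point w → w = v := by
        rintro w v rfl
        rcases heab w (φ.point_mem_arc.1 hze) with rfl | rfl <;> simp at hzab
      obtain ⟨ha, hb⟩ : a ∈ e.1 ∧ b ∈ e.1 := by
        obtain ⟨⟨u, v⟩, huv⟩ := e
        have hne := G.ne_of_adj huv
        have h1 := heab u (Sym2.mem_mk_left u v)
        have h2 := heab v (Sym2.mem_mk_right u v)
        rcases h1 with rfl | rfl <;> rcases h2 with rfl | rfl
        · exact absurd rfl hne
        · exact ⟨Sym2.mem_mk_left _ _, Sym2.mem_mk_right _ _⟩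
        · exact ⟨Sym2.mem_mk_right _ _, Sym2.mem_mk_left _ _⟩
        · exact absurd rfl hne
      have h1 : (fax + fxy) z = fay z := by
        refine eq_of_exp_eq (E := edgesIn ({a} ∪ X) ∪ edgesIn (X ∪ Y) ∪ edgesIn ({a} ∪ Y))
          hF hFd hcl ((hl1 cax ?_).add (hl1 cxy ?_)) (hl1 cay ?_)
          (fun z hz => ?_) hpF ?_ ?_ hb hze fun w => hzw w b
        · exact Set.subset_union_left.trans Set.subset_union_left
        · exact Set.subset_union_right.trans Set.subset_union_left
        · exact Set.subset_union_right
        · rw [eay z (hl2 hz Set.subset_union_right)]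
          exact htel ((G.connectedOn_singleton a).union h.connX rfl hxa haxa) (Or.inl rfl)
            (Or.inr hx) (fun h' => haX (h' ▸ hx)) eax exy
            (hl2 hz (Set.subset_union_left.trans Set.subset_union_left))
            (hl2 hz (Set.subset_union_right.trans Set.subset_union_left))
        · simp only [Pi.add_apply, pax, pxy, pay]; ring
        · rintro e' - ((he' | he') | he') hv' <;> rcases he' _ hv' with h' | h'
          exacts [h.ne h'.symm, hbX h', hbX h', hbY h', h.ne h'.symm, hbY h']
      have h2 : fxb z = (fxy + fyb) z := by
        refine eq_of_exp_eq (E := edgesIn (X ∪ {b}) ∪ edgesIn (X ∪ Y) ∪ edgesIn (Y ∪ {b}))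
          hF hFd hcl (hl1 cxb ?_) ((hl1 cxy ?_).add (hl1 cyb ?_))
          (fun z hz => ?_) hpF ?_ ?_ ha hze fun w => hzw w a
        · exact Set.subset_union_left.trans Set.subset_union_left
        · exact Set.subset_union_right.trans Set.subset_union_left
        · exact Set.subset_union_right
        · rw [exb z (hl2 hz (Set.subset_union_left.trans Set.subset_union_left))]
          exact (htel (h.connX.union h.connY hx hy hxy) (Or.inl hx) (Or.inr hy)
            (fun h' => h.disjoint_XY _ hx (h' ▸ hy)) exy eyb
            (hl2 hz (Set.subset_union_right.trans Set.subset_union_left))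
            (hl2 hz Set.subset_union_right)).symm
        · simp only [Pi.add_apply, pxb, pxy, pyb]; ring
        · rintro e' - ((he' | he') | he') hv' <;> rcases he' _ hv' with h' | h'
          exacts [haX h', h.ne h', haX h', haY h', haY h', h.ne h']
      simp only [Pi.add_apply] at h1 h2 ⊢
      rw [← h1, h2]
      ring

/-! ### Vertices of degree at most two -/

/-- The vertices `p 0, …, p k` form a path of `G`. -/
def IsPathSeq (G : SimpleGraph V) (k : ℕ) (p : ℕ → V) : Prop :=
  (∀ m ≤ k, ∀ n ≤ k, p m = p n → m = n) ∧ ∀ j < k, G.Adj (p j) (p (j + 1))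

theorem IsPathSeq.connectedOn {G : SimpleGraph V} {k : ℕ} {p : ℕ → V} (h : G.IsPathSeq k p)
    {m n : ℕ} (hn : n ≤ k) : G.ConnectedOn (p '' Set.Icc m n) := by
  have key : ∀ d i, m ≤ i → i + d ≤ n → Relation.ReflTransGen
      (fun x y => G.Adj x y ∧ x ∈ p '' Set.Icc m n ∧ y ∈ p '' Set.Icc m n) (p i) (p (i + d)) := by
    intro d
    induction d with
    | zero => intro i _ _; exact .refl
    | succ d ih =>
      intro i hi hd
      exact (ih i hi (by omega)).tail ⟨h.2 (i + d) (by omega), ⟨_, ⟨by omega, by omega⟩, rfl⟩,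
        ⟨_, ⟨by omega, by omega⟩, rfl⟩⟩
  have hsymm : Std.Symm (fun x y => G.Adj x y ∧ x ∈ p '' Set.Icc m n ∧ y ∈ p '' Set.Icc m n) :=
    ⟨fun x y h => ⟨h.1.symm, h.2.2, h.2.1⟩⟩
  rintro _ ⟨i, hi, rfl⟩ _ ⟨j, hj, rfl⟩
  rcases le_total i j with hij | hij
  · obtain ⟨d, rfl⟩ := Nat.exists_eq_add_of_le hij
    exact key d i hi.1 hj.2
  · obtain ⟨d, rfl⟩ := Nat.exists_eq_add_of_le hij
    exact symm_of _ (key d j hj.1 hi.2)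

theorem IsPathSeq.cons {G : SimpleGraph V} {k : ℕ} {p : ℕ → V} (h : G.IsPathSeq k p) {y : V}
    (hy : G.Adj y (p 0)) (hyp : ∀ j ≤ k, y ≠ p j) :
    G.IsPathSeq (k + 1) (fun j => if j = 0 then y else p (j - 1)) := by
  constructor
  · rintro (_ | i) hi (_ | j) hj hij
    · rfl
    · exact absurd (by simpa using hij) (hyp j (by omega))
    · exact absurd (by simpa using hij.symm) (hyp i (by omega))
    · have := h.1 (i) (by omega) (j) (by omega) (by simpa using hij)
      omega
  · rintro (_ | j) hj
    · simpa using hy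
    · have := h.2 j (by omega)
      simpa using this

/-- The chord from `p 0` to `p i` allows the segment before `p i` to be reversed; the new path has
the same vertices and starts at `p (i - 1)`. -/
theorem IsPathSeq.rotate {G : SimpleGraph V} {k i : ℕ} {p : ℕ → V} (h : G.IsPathSeq k p)
    (hik : i ≤ k) (h0 : G.Adj (p 0) (p i)) :
    G.IsPathSeq k (fun j => if j < i then p (i - 1 - j) else p j) := by
  constructor
  · intro x hx y hy hxy
    simp only at hxy
    split_ifs at hxy with h1 h2 h2
    · have := h.1 (i - 1 - x) (by omega) (i - 1 - y) (by omega) hxy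
      omega
    · have := h.1 (i - 1 - x) (by omega) (y) (by omega) hxy
      omega
    · have := h.1 (x) (by omega) (i - 1 - y) (by omega) hxy
      omega
    · exact h.1 (x) (by omega) (y) (by omega) hxy
  · intro j hj
    simp only
    rcases lt_trichotomy (j + 1) i with h1 | h1 | h1
    · rw [if_pos (by omega), if_pos h1]
      have := h.2 (i - 1 - (j + 1)) (by omega)
      rw [show i - 1 - (j + 1) + 1 = i - 1 - j by omega] at this
      exact this.symm
    · rw [if_pos (by omega), if_neg (by omega), h1, show i - 1 - j = 0 by omega]
      exact h0
    · rw [if_neg (by omega), if_neg (by omega)]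
      exact h.2 j hj

/-- All neighbours of the first vertex of a longest path lie on the path. Take a longest path whose
first vertex has a chord to the smallest possible index `i`. Both `p 0` and, by rotation, `p (i -
1)` then have neighbours beyond `p i`, so the tail of the path attaches to the cycle `p 0, …, p i`
at `p 0`, `p (i - 1)` and `p i`. -/
theorem exists_isK4Model_of_two_lt_degree [Finite V] {G : SimpleGraph V} {x₀ y₀ : V}
    (h₀ : G.Adj x₀ y₀)
    (hdeg : ∀ v u w, G.Adj v u → G.Adj v w → ∃ x, G.Adj v x ∧ x ≠ u ∧ x ≠ w) :
    ∃ a b X Y Z, G.IsK4Model a b X Y Z := by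
  classical
  have hbd : ∀ k p, G.IsPathSeq k p → k < Nat.card V := by
    intro k p hp
    have := Set.ncard_le_card (p '' Set.Iic k)
    rw [Set.InjOn.ncard_image (s := Set.Iic k) fun m hm n hn => hp.1 m hm n hn] at this
    have h2 : (Set.Iic k).ncard = k + 1 := by
      rw [← Finset.coe_Iic, Set.ncard_coe_finset, Nat.card_Iic]
    omega
  have h1 : ∃ p, G.IsPathSeq 1 p := by
    refine ⟨fun j => if j = 0 then x₀ else y₀, ?_, ?_⟩
    · intro i hi j hj hij
      have := G.ne_of_adj h₀
      interval_cases i <;> interval_cases j <;> simp_all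
    · intro j hj
      obtain rfl : j = 0 := by omega
      simpa using h₀
  obtain ⟨k, ⟨hk1, p₀, hp₀⟩, hmax⟩ : ∃ k, (1 ≤ k ∧ ∃ p, G.IsPathSeq k p) ∧
      ∀ p, ¬ G.IsPathSeq (k + 1) p := by
    let P : ℕ → Prop := fun k => 1 ≤ k ∧ ∃ p, G.IsPathSeq k p
    have hP : P 1 := ⟨le_rfl, h1⟩
    have hc : 1 ≤ Nat.card V := (hbd _ _ h1.choose_spec).le
    refine ⟨Nat.findGreatest P (Nat.card V), Nat.findGreatest_spec (P := P) hc hP, fun p hp => ?_⟩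
    have := Nat.le_findGreatest (P := P) (hbd _ _ hp).le ⟨by omega, p, hp⟩
    omega
  have hnb : ∀ p, G.IsPathSeq k p → ∀ y, G.Adj (p 0) y → ∃ j ≤ k, 1 ≤ j ∧ y = p j := by
    intro p hp y hy
    by_contra! hcon
    refine hmax _ (hp.cons hy.symm fun j hj => ?_)
    rcases Nat.eq_zero_or_pos j with rfl | hj0
    · exact (G.ne_of_adj hy).symm
    · exact hcon j hj hj0
  have hthird : ∀ p, G.IsPathSeq k p → ∀ i, G.Adj (p 0) (p i) →
      ∃ j ≤ k, 2 ≤ j ∧ j ≠ i ∧ G.Adj (p 0) (p j) := by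
    intro p hp i hi
    obtain ⟨y, hy, hy1, hyi⟩ := hdeg (p 0) (p 1) (p i) (hp.2 0 (by omega)) hi
    obtain ⟨j, hj, hj1, rfl⟩ := hnb p hp y hy
    refine ⟨j, hj, ?_, fun h => hyi (h ▸ rfl), hy⟩
    have : j ≠ 1 := fun h => hy1 (h ▸ rfl)
    omega
  have hex : ∃ i, ∃ p, G.IsPathSeq k p ∧ 2 ≤ i ∧ i ≤ k ∧ G.Adj (p 0) (p i) := by
    obtain ⟨j, hj, hj2, -, hadj⟩ := hthird p₀ hp₀ 1 (hp₀.2 0 (by omega))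
    exact ⟨j, p₀, hp₀, hj2, hj, hadj⟩
  obtain ⟨p, hp, hi2, hik, hadj⟩ := Nat.find_spec hex
  have hmin := fun m hm => Nat.find_min hex (m := m) hm
  set i := Nat.find hex
  have hinj := hp.1
  obtain ⟨j, hj, hj2, hji, hadj'⟩ := hthird p hp i hadj
  have hij : i < j := by
    by_contra hlt
    exact hmin j (by omega) ⟨p, hp, hj2, hj, hadj'⟩
  -- The rotated path is also longest, so the minimality of `i` applies to its first vertex `p (i -
  -- 1)`.
  have hq := hp.rotate hik hadj
  have hlast : G.Adj (p (i - 1)) (p i) := by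
    have := hp.2 (i - 1) (by omega)
    rwa [show i - 1 + 1 = i by omega] at this
  obtain ⟨b, hb, hb2, hbi, hadjb⟩ := hthird _ hq i (by
    rw [if_pos (by omega), if_neg (by omega)]
    exact hlast)
  have hib : i < b := by
    by_contra hlt
    exact hmin b (by omega) ⟨_, hq, hb2, hb, hadjb⟩
  rw [if_pos (by omega), if_neg (by omega)] at hadjb
  refine ⟨p 0, p i, p '' Set.Icc 1 (i - 1), p '' Set.Icc (i + 1) k, {p 0, p i}, ?_⟩
  refine ⟨fun h => ?_, by simp, by simp, ?_, ?_, ?_, hp.connectedOn (by omega),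
    hp.connectedOn le_rfl, ?_, ⟨p 1, ⟨1, ⟨by omega, by omega⟩, rfl⟩, hp.2 0 (by omega)⟩,
    ⟨p (i - 1), ⟨i - 1, ⟨by omega, by omega⟩, rfl⟩, hlast.symm⟩,
    ⟨p j, ⟨j, ⟨by omega, by omega⟩, rfl⟩, hadj'⟩,
    ⟨p (i + 1), ⟨i + 1, ⟨by omega, by omega⟩, rfl⟩, hp.2 i (by omega)⟩,
    ⟨p (i - 1), ⟨i - 1, ⟨by omega, by omega⟩, rfl⟩, p b, ⟨b, ⟨by omega, by omega⟩, rfl⟩, hadjb⟩⟩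
  · have := hinj _ (by omega) _ hik h
    omega
  · rintro _ ⟨m, hm, rfl⟩ ⟨n, hn, hmn⟩
    have := hinj _ hn.2 _ (by have := hm.2; omega) hmn
    have := hm.2; have := hn.1
    omega
  · rintro _ ⟨m, hm, rfl⟩ (h | h)
    · have := hinj _ (by have := hm.2; omega) _ (by omega) h
      have := hm.1; omega
    · have := hinj _ (by have := hm.2; omega) _ hik h
      have := hm.2; omega
  · rintro _ ⟨m, hm, rfl⟩ (h | h)
    · have := hinj _ hm.2 _ (by omega) h
      have := hm.1; omega
    · have := hinj _ hm.2 _ hik h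
      have := hm.1; omega
  · have := (G.connectedOn_singleton (p 0)).union (G.connectedOn_singleton (p i)) rfl rfl hadj
    exact this

/-! ### Suppressing a vertex -/

/-- Delete the edges at `v` and join `u` and `w`. -/
def suppress (G : SimpleGraph V) (v u w : V) : SimpleGraph V where
  Adj x y := (G.Adj x y ∧ x ≠ v ∧ y ≠ v) ∨ (u ≠ w ∧ ((x = u ∧ y = w) ∨ (x = w ∧ y = u)))
  symm := ⟨fun x y h => by
    rcases h with h | ⟨h, h' | h'⟩
    exacts [Or.inl ⟨h.1.symm, h.2.2, h.2.1⟩, Or.inr ⟨h, Or.inr ⟨h'.2, h'.1⟩⟩,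
      Or.inr ⟨h, Or.inl ⟨h'.2, h'.1⟩⟩]⟩
  loopless := ⟨fun x h => by
    rcases h with h | ⟨h, h' | h'⟩
    exacts [G.loopless.irrefl x h.1, h (h'.1.symm.trans h'.2), h (h'.2.symm.trans h'.1)]⟩

theorem suppress_comm (G : SimpleGraph V) (v u w : V) : G.suppress v u w = G.suppress v w u := by
  ext x y
  simp only [suppress, ne_comm (a := u), or_comm (a := x = u ∧ y = w)]

theorem IsK4Model.swap {G : SimpleGraph V} {a b : V} {X Y Z : Set V} (h : G.IsK4Model a b X Y Z) :
    G.IsK4Model a b Y X Z :=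
  ⟨h.ne, h.left_mem, h.right_mem, fun v hv hv' => h.disjoint_XY v hv' hv, h.disjoint_YZ,
    h.disjoint_XZ, h.connY, h.connX, h.connZ, h.adj_aY, h.adj_bY, h.adj_aX, h.adj_bX,
    let ⟨x, hx, y, hy, hxy⟩ := h.adj_XY; ⟨y, hy, x, hx, hxy.symm⟩⟩

theorem ConnectedOn.mono {G H : SimpleGraph V} {S : Set V} (hS : G.ConnectedOn S)
    (h : ∀ x ∈ S, ∀ y ∈ S, G.Adj x y → H.Adj x y) : H.ConnectedOn S := fun x hx y hy =>
  (hS x hx y hy).lift id fun a b hab => ⟨h a hab.2.1 b hab.2.2 hab.1, hab.2⟩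

theorem IsK4Model.mono {G H : SimpleGraph V} {a b : V} {X Y Z : Set V} (h : G.IsK4Model a b X Y Z)
    (hGH : ∀ x y, G.Adj x y → H.Adj x y) : H.IsK4Model a b X Y Z :=
  ⟨h.ne, h.left_mem, h.right_mem, h.disjoint_XY, h.disjoint_XZ, h.disjoint_YZ,
    h.connX.mono fun x _ y _ => hGH x y, h.connY.mono fun x _ y _ => hGH x y,
    h.connZ.mono fun x _ y _ => hGH x y, h.adj_aX.imp fun _ h => ⟨h.1, hGH _ _ h.2⟩,
    h.adj_bX.imp fun _ h => ⟨h.1, hGH _ _ h.2⟩, h.adj_aY.imp fun _ h => ⟨h.1, hGH _ _ h.2⟩,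
    h.adj_bY.imp fun _ h => ⟨h.1, hGH _ _ h.2⟩,
    h.adj_XY.imp fun _ h => ⟨h.1, h.2.imp fun _ h => ⟨h.1, hGH _ _ h.2⟩⟩⟩

variable {G : SimpleGraph V} {v u w : V}

theorem not_suppress_adj (hu : G.Adj v u) (hw : G.Adj v w) (x : V) :
    ¬ (G.suppress v u w).Adj v x := by
  rintro (h | ⟨-, h | h⟩)
  · exact h.2.1 rfl
  · exact G.ne_of_adj hu h.1
  · exact G.ne_of_adj hw h.1

theorem connectedOn_insert_of_suppress {S : Set V} (hu : G.Adj v u) (hw : G.Adj v w)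
    (hS : (G.suppress v u w).ConnectedOn S) (huS : u ∈ S) : G.ConnectedOn (insert v S) := by
  set R := fun x y => G.Adj x y ∧ x ∈ insert v S ∧ y ∈ insert v S with hR
  have hvu : Relation.ReflTransGen R v u := .single ⟨hu, Or.inl rfl, Or.inr huS⟩
  have huv : Relation.ReflTransGen R u v := .single ⟨hu.symm, Or.inr huS, Or.inl rfl⟩
  have key : ∀ x ∈ S, ∀ y ∈ S, Relation.ReflTransGen R x y := by
    intro x hx y hy
    induction hS x hx y hy with
    | refl => exact .refl
    | @tail b c _ hbc ih =>
      refine (ih hbc.2.1).trans ?_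
      rcases hbc.1 with h | ⟨-, ⟨rfl, rfl⟩ | ⟨rfl, rfl⟩⟩
      · exact .single ⟨h.1, Or.inr hbc.2.1, Or.inr hbc.2.2⟩
      · exact huv.tail ⟨hw, Or.inl rfl, Or.inr hbc.2.2⟩
      · exact .head ⟨hw.symm, Or.inr hbc.2.1, Or.inl rfl⟩ hvu
  rintro x (rfl | hx) y (rfl | hy)
  · exact .refl
  · exact hvu.trans (key u huS y hy)
  · exact (key x hx u huS).trans huv
  · exact key x hx y hy

theorem connectedOn_of_suppress {S : Set V} (hS : (G.suppress v u w).ConnectedOn S)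
    (h : ¬ (u ∈ S ∧ w ∈ S)) : G.ConnectedOn S :=
  hS.mono fun x hx y hy hxy => by
    rcases hxy with h' | ⟨-, ⟨rfl, rfl⟩ | ⟨rfl, rfl⟩⟩
    exacts [h'.1, absurd ⟨hx, hy⟩ h, absurd ⟨hy, hx⟩ h]

/-- Being isolated after the suppression, `v` belongs to none of the three sets. It is added to one
that contains `u` or `w`, with `X` and `Y` tried before `Z`; the path `u v w` then does the work of
the edge `uw`. If `u` lies in no set, or neither end lies in one, the new edge plays no role and `Z`
is left alone. -/
theorem IsK4Model.exists_of_suppress {a b : V} {X Y Z : Set V} (hu : G.Adj v u) (hw : G.Adj v w)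
    (h : (G.suppress v u w).IsK4Model a b X Y Z) : ∃ a b X Y Z, G.IsK4Model a b X Y Z := by
  have hnv := not_suppress_adj hu hw
  have hva : v ≠ a := by rintro rfl; obtain ⟨x, -, hx⟩ := h.adj_aX; exact hnv x hx
  have hiso : ∀ {S : Set V} {t : V}, (G.suppress v u w).ConnectedOn S → t ∈ S → v ≠ t → v ∉ S := by
    intro S t hS ht hvt hv
    rcases (hS v hv t ht).cases_head with h' | ⟨c, hc, -⟩
    exacts [hvt h', hnv c hc.1]
  have hvZ : v ∉ Z := hiso h.connZ h.left_mem hva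
  have hvX : v ∉ X := by
    obtain ⟨x, hx, hax⟩ := h.adj_aX
    exact hiso h.connX hx fun hv => hnv a (hv ▸ hax.symm)
  have hvY : v ∉ Y := by
    obtain ⟨x, hx, hax⟩ := h.adj_aY
    exact hiso h.connY hx fun hv => hnv a (hv ▸ hax.symm)
  have hX : ∀ {u w : V} {X Y : Set V}, G.Adj v u → G.Adj v w →
      (G.suppress v u w).IsK4Model a b X Y Z → v ∉ Y → u ∈ X → G.IsK4Model a b (insert v X) Y Z := by
    intro u w X Y hu hw h hvY huX
    have hadj : ∀ {x y}, (G.suppress v u w).Adj y x → y ∉ X → x ∈ X → ∃ x ∈ insert v X, G.Adj y x := by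
      rintro x y (h' | ⟨-, ⟨rfl, rfl⟩ | ⟨rfl, rfl⟩⟩) hy hx
      · exact ⟨x, Or.inr hx, h'.1⟩
      · exact absurd huX hy
      · exact ⟨v, Or.inl rfl, hw.symm⟩
    have hadj' : ∀ {x y}, (G.suppress v u w).Adj y x → y ∉ X → x ∉ X → G.Adj y x := by
      rintro x y (h' | ⟨-, ⟨rfl, rfl⟩ | ⟨rfl, rfl⟩⟩) hy hx
      exacts [h'.1, absurd huX hy, absurd huX hx]
    have haX : a ∉ X := fun h' => h.disjoint_XZ a h' h.left_mem
    have hbX : b ∉ X := fun h' => h.disjoint_XZ b h' h.right_mem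
    have hYX : ∀ y ∈ Y, y ∉ X := fun y hy hy' => h.disjoint_XY y hy' hy
    refine ⟨h.ne, h.left_mem, h.right_mem, ?_, ?_, h.disjoint_YZ,
      connectedOn_insert_of_suppress hu hw h.connX huX,
      connectedOn_of_suppress h.connY fun h' => hYX u h'.1 huX,
      connectedOn_of_suppress h.connZ fun h' => h.disjoint_XZ u huX h'.1, ?_, ?_, ?_, ?_, ?_⟩
    · rintro x (rfl | hx)
      exacts [hvY, h.disjoint_XY x hx]
    · rintro x (rfl | hx)
      exacts [hvZ, h.disjoint_XZ x hx]
    · obtain ⟨x, hx, hax⟩ := h.adj_aX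
      exact hadj hax haX hx
    · obtain ⟨x, hx, hax⟩ := h.adj_bX
      exact hadj hax hbX hx
    · obtain ⟨y, hy, hay⟩ := h.adj_aY
      exact ⟨y, hy, hadj' hay haX (hYX y hy)⟩
    · obtain ⟨y, hy, hay⟩ := h.adj_bY
      exact ⟨y, hy, hadj' hay hbX (hYX y hy)⟩
    · obtain ⟨x, hx, y, hy, hxy⟩ := h.adj_XY
      obtain ⟨x', hx', hyx'⟩ := hadj hxy.symm (hYX y hy) hx
      exact ⟨x', hx', y, hy, hyx'.symm⟩
  by_cases huX : u ∈ X
  · exact ⟨_, _, _, _, _, hX hu hw h hvY huX⟩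
  by_cases hwX : w ∈ X
  · exact ⟨_, _, _, _, _, hX hw hu (suppress_comm G v u w ▸ h) hvY hwX⟩
  by_cases huY : u ∈ Y
  · exact ⟨_, _, _, _, _, hX hu hw h.swap hvX huY⟩
  by_cases hwY : w ∈ Y
  · exact ⟨_, _, _, _, _, hX hw hu (suppress_comm G v u w ▸ h.swap) hvX hwY⟩
  have hadj : ∀ {x y}, (G.suppress v u w).Adj x y → y ∈ X ∨ y ∈ Y → G.Adj x y := by
    rintro x y (h' | ⟨-, ⟨rfl, rfl⟩ | ⟨rfl, rfl⟩⟩) hy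
    · exact h'.1
    · rcases hy with hy | hy
      exacts [absurd hy hwX, absurd hy hwY]
    · rcases hy with hy | hy
      exacts [absurd hy huX, absurd hy huY]
  have hmk : ∀ Z', Z ⊆ Z' → (∀ v ∈ X, v ∉ Z') → (∀ v ∈ Y, v ∉ Z') → G.ConnectedOn Z' →
      G.IsK4Model a b X Y Z' := fun Z' hZ h1 h2 h3 =>
    ⟨h.ne, hZ h.left_mem, hZ h.right_mem, h.disjoint_XY, h1, h2,
      connectedOn_of_suppress h.connX fun h' => huX h'.1,
      connectedOn_of_suppress h.connY fun h' => huY h'.1, h3,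
      h.adj_aX.imp fun x hx => ⟨hx.1, hadj hx.2 (Or.inl hx.1)⟩,
      h.adj_bX.imp fun x hx => ⟨hx.1, hadj hx.2 (Or.inl hx.1)⟩,
      h.adj_aY.imp fun x hx => ⟨hx.1, hadj hx.2 (Or.inr hx.1)⟩,
      h.adj_bY.imp fun x hx => ⟨hx.1, hadj hx.2 (Or.inr hx.1)⟩,
      h.adj_XY.imp fun x hx => ⟨hx.1, hx.2.imp fun y hy => ⟨hy.1, hadj hy.2 (Or.inr hy.1)⟩⟩⟩
  by_cases huZ : u ∈ Z
  · refine ⟨_, _, _, _, _, hmk (insert v Z) (Set.subset_insert _ _) ?_ ?_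
      (connectedOn_insert_of_suppress hu hw h.connZ huZ)⟩
    · rintro x hx (rfl | hx')
      exacts [hvX hx, h.disjoint_XZ x hx hx']
    · rintro x hx (rfl | hx')
      exacts [hvY hx, h.disjoint_YZ x hx hx']
  · exact ⟨_, _, _, _, _, hmk Z subset_rfl h.disjoint_XZ h.disjoint_YZ
      (connectedOn_of_suppress h.connZ fun h' => huZ h'.1)⟩

/-! ### White components and the positive colour change rule -/

/-- `x` and `y` are joined by a path of vertices outside `S`. -/
def WhiteReach (G : SimpleGraph V) (S : Set V) (x y : V) : Prop :=
  Relation.ReflTransGen (fun x y => G.Adj x y ∧ x ∉ S ∧ y ∉ S) x y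

theorem WhiteReach.symm {G : SimpleGraph V} {S : Set V} {x y : V} (h : G.WhiteReach S x y) :
    G.WhiteReach S y x := by
  have hsymm : Std.Symm (fun x y => G.Adj x y ∧ x ∉ S ∧ y ∉ S) :=
    ⟨fun x y h => ⟨h.1.symm, h.2.2, h.2.1⟩⟩
  exact symm_of (Relation.ReflTransGen fun x y => G.Adj x y ∧ x ∉ S ∧ y ∉ S) h

theorem WhiteReach.mono {G H : SimpleGraph V} {S T : Set V} {x y : V} (h : G.WhiteReach S x y)
    (hGH : ∀ x y, G.Adj x y → x ∉ S → y ∉ S → H.Adj x y ∧ x ∉ T ∧ y ∉ T) :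
    H.WhiteReach T x y :=
  h.lift id fun x y h => hGH x y h.1 h.2.1 h.2.2

theorem reachable_induce_compl_iff {G : SimpleGraph V} {S : Set V} {x y : V} (hx : x ∈ Sᶜ)
    (hy : y ∈ Sᶜ) : (G.induce Sᶜ).Reachable ⟨x, hx⟩ ⟨y, hy⟩ ↔ G.WhiteReach S x y := by
  rw [reachable_iff_reflTransGen]
  constructor
  · intro h
    have key : ∀ z, Relation.ReflTransGen (G.induce Sᶜ).Adj ⟨x, hx⟩ z → G.WhiteReach S x z := by
      intro z h
      induction h with
      | refl => exact .refl
      | @tail b c _ hbc ih => exact ih.tail ⟨hbc, b.2, c.2⟩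
    exact key _ h
  · intro h
    have key : ∀ z, G.WhiteReach S x z → ∀ hz : z ∈ Sᶜ,
        Relation.ReflTransGen (G.induce Sᶜ).Adj ⟨x, hx⟩ ⟨z, hz⟩ := by
      intro z h
      induction h with
      | refl => intro _; exact .refl
      | tail _ hbc ih => exact fun hz => (ih hbc.2.1).tail hbc.1
    exact key y h hy

/-- Components are types depending on the graph and on the black set; a relation on `V` can be
compared across different graphs and black sets. -/
theorem positiveForces_iff {G : SimpleGraph V} {S : Set V} {p q : V} :
    G.PositiveForces S p q ↔ p ∈ S ∧ q ∉ S ∧ G.Adj p q ∧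
      ∀ x, G.Adj p x → x ∉ S → G.WhiteReach S q x → x = q := by
  constructor
  · rintro ⟨hp, W, hW⟩
    have hq : q ∈ ({q} : Set V) := rfl
    rw [← hW] at hq
    obtain ⟨hpq, hqS, rfl⟩ := hq
    refine ⟨hp, hqS, hpq, fun x hpx hx hqx => ?_⟩
    have : x ∈ ({q} : Set V) := by
      rw [← hW]
      exact ⟨hpx, hx, ConnectedComponent.sound ((reachable_induce_compl_iff _ _).2 hqx.symm)⟩
    exact this
  · rintro ⟨hp, hq, hpq, h⟩
    refine ⟨hp, (G.induce Sᶜ).connectedComponentMk ⟨q, hq⟩, ?_⟩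
    ext x
    constructor
    · rintro ⟨hpx, hx, hxq⟩
      exact h x hpx hx ((reachable_induce_compl_iff hx hq).1 (ConnectedComponent.exact hxq)).symm
    · rintro rfl
      exact ⟨hpq, hq, rfl⟩

/-! ### Lifting forces along a suppression -/

section Lift

variable {G : SimpleGraph V} {v u w : V} {S : Set V} {p q : V}

/-- A passage through `v` is replaced by the edge `uw`; a walk that ends at `v` is cut off at the
neighbour of `v` before it. -/
theorem whiteReach_of_suppress (hu : G.Adj v u) (hw : G.Adj v w)
    (hN : ∀ x, G.Adj v x → x = u ∨ x = w) (hqv : q ≠ v) {x : V} (h : G.WhiteReach S q x) :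
    (x ≠ v → (G.suppress v u w).WhiteReach (insert v S) q x) ∧
    (x = v → ∃ z, (z = u ∨ z = w) ∧ z ∉ S ∧ (G.suppress v u w).WhiteReach (insert v S) q z) := by
  have hadj : ∀ z z', (z = u ∨ z = w) → (z' = u ∨ z' = w) → z ≠ z' →
      (G.suppress v u w).Adj z z' := by
    rintro z z' (rfl | rfl) (rfl | rfl) hne
    · exact absurd rfl hne
    · exact Or.inr ⟨hne, Or.inl ⟨rfl, rfl⟩⟩
    · exact Or.inr ⟨hne.symm, Or.inr ⟨rfl, rfl⟩⟩
    · exact absurd rfl hne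
  have hins : ∀ z, z ≠ v → z ∉ S → z ∉ insert v S := fun z h1 h2 h3 => h3.elim h1 h2
  have hnev : ∀ z, (z = u ∨ z = w) → z ≠ v := by
    rintro z (rfl | rfl)
    exacts [(G.ne_of_adj hu).symm, (G.ne_of_adj hw).symm]
  induction h with
  | refl => exact ⟨fun _ => .refl, fun h => absurd h hqv⟩
  | @tail b c _ hbc ih =>
    obtain ⟨hbc, hb, hc⟩ := hbc
    by_cases hbv : b = v
    · subst hbv
      have hcb : c ≠ b := (G.ne_of_adj hbc).symm
      refine ⟨fun _ => ?_, fun h => absurd h hcb⟩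
      obtain ⟨z, hz, hzS, hqz⟩ := ih.2 rfl
      by_cases hzc : z = c
      · exact hzc ▸ hqz
      · exact hqz.tail ⟨hadj z c hz (hN c hbc) hzc, hins z (hnev z hz) hzS, hins c hcb hc⟩
    · refine ⟨fun hcv => ?_, ?_⟩
      · exact (ih.1 hbv).tail ⟨Or.inl ⟨hbc, hbv, hcv⟩, hins b hbv hb, hins c hcv hc⟩
      · rintro rfl
        exact ⟨b, hN b hbc.symm, hb, ih.1 hbv⟩

/-- Only `v` could be a further white neighbour of `p` in the component of `q`. In that case `p` is
one of `u`, `w` and the other is a white neighbour of `p` in the suppressed graph, in the component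
of `q`; so it is `q`, and the force runs along the new edge. -/
theorem PositiveForces.of_suppress (hu : G.Adj v u) (hw : G.Adj v w)
    (hN : ∀ x, G.Adj v x → x = u ∨ x = w) (h : (G.suppress v u w).PositiveForces (insert v S) p q)
    (h1 : ¬ (p = u ∧ q = w)) (h2 : ¬ (p = w ∧ q = u)) : G.PositiveForces S p q := by
  rw [positiveForces_iff] at h ⊢
  obtain ⟨hp, hq, hpq, huniq⟩ := h
  have hpv : p ≠ v := by
    rintro rfl
    exact not_suppress_adj hu hw q hpq
  have hqv : q ≠ v := fun h' => hq (Or.inl h')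
  have hqS : q ∉ S := fun h' => hq (Or.inr h')
  have hpS : p ∈ S := hp.resolve_left hpv
  refine ⟨hpS, hqS, ?_, fun x hpx hx hqx => ?_⟩
  · rcases hpq with h' | ⟨-, h' | h'⟩
    exacts [h'.1, absurd h' h1, absurd h' h2]
  · have key := whiteReach_of_suppress hu hw hN hqv hqx
    by_cases hxv : x = v
    · subst hxv
      obtain ⟨z, hz, hzS, hqz⟩ := key.2 rfl
      have hpz : p ≠ z := fun h' => hzS (h' ▸ hpS)
      have hzv : z ≠ x := by
        rcases hz with rfl | rfl
        exacts [(G.ne_of_adj hu).symm, (G.ne_of_adj hw).symm]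
      have hadj : (G.suppress x u w).Adj p z := by
        rcases hN p hpx.symm with rfl | rfl <;> rcases hz with rfl | rfl
        · exact absurd rfl hpz
        · exact Or.inr ⟨hpz, Or.inl ⟨rfl, rfl⟩⟩
        · exact Or.inr ⟨hpz.symm, Or.inr ⟨rfl, rfl⟩⟩
        · exact absurd rfl hpz
      have hzq := huniq z hadj (fun h' => h'.elim hzv hzS) hqz
      subst hzq
      rcases hN p hpx.symm with rfl | rfl <;> rcases hz with rfl | rfl
      exacts [absurd rfl hpz, absurd ⟨rfl, rfl⟩ h1, absurd ⟨rfl, rfl⟩ h2, absurd rfl hpz]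
    · exact huniq x (Or.inl ⟨hpx, hpv, hxv⟩) (fun h' => h'.elim hxv hx) (key.1 hxv)

/-- While `v` and `w` are white they share a component of `G`, so a second neighbour of `u` there
would already obstruct the force from `u` to `w`; `w` itself is excluded by `huw`. Afterwards `w` is
the only white neighbour of `v`. -/
theorem PositiveForces.subdivide_of_suppress (hu : G.Adj v u) (hw : G.Adj v w)
    (hN : ∀ x, G.Adj v x → x = u ∨ x = w) (hvS : v ∉ S) (huw : ¬ G.Adj u w)
    (h : (G.suppress v u w).PositiveForces (insert v S) u w) :
    G.PositiveForces S u v ∧ G.PositiveForces (insert v S) v w := by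
  rw [positiveForces_iff] at h
  obtain ⟨hp, hq, hpq, huniq⟩ := h
  have huv : u ≠ v := (G.ne_of_adj hu).symm
  have hwv : w ≠ v := (G.ne_of_adj hw).symm
  have huS : u ∈ S := hp.resolve_left huv
  have hwS : w ∉ S := fun h' => hq (Or.inr h')
  refine ⟨positiveForces_iff.2 ⟨huS, hvS, hu.symm, fun x hux hx hvx => ?_⟩,
    positiveForces_iff.2 ⟨Or.inl rfl, hq, hw, fun x hvx hx _ => ?_⟩⟩
  · by_contra hxv
    have hwx : G.WhiteReach S w x := Relation.ReflTransGen.head ⟨hw.symm, hwS, hvS⟩ hvx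
    have := huniq x (Or.inl ⟨hux, huv, hxv⟩) (fun h' => h'.elim hxv hx)
      ((whiteReach_of_suppress hu hw hN hwv hwx).1 hxv)
    exact huw (this ▸ hux)
  · rcases hN x hvx with rfl | rfl
    exacts [absurd (Or.inr huS) hx, rfl]

/-- With `v` black, no white walk uses an edge at `v`, and an edge missing from `G` has both ends
black and carries no force. -/
theorem PositiveForcing.of_suppress_of_mem {C : Set V} {L : List (V × V)}
    (h : (G.suppress v u w).PositiveForcing S L C) (hvS : v ∈ S)
    (hS : ∀ x y, (G.suppress v u w).Adj x y → x ≠ v ∧ y ≠ v ∧ (G.Adj x y ∨ (x ∈ S ∧ y ∈ S))) :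
    G.PositiveForcing S L C := by
  induction h with
  | nil B => exact .nil B
  | @cons B C p q L h hL ih =>
    refine .cons ?_ (ih (Or.inr hvS) fun x y hxy => ⟨(hS x y hxy).1, (hS x y hxy).2.1,
      (hS x y hxy).2.2.imp_right fun h' => ⟨Or.inr h'.1, Or.inr h'.2⟩⟩)
    rw [positiveForces_iff] at h ⊢
    obtain ⟨hp, hq, hpq, huniq⟩ := h
    obtain ⟨hpv, hqv, hpq'⟩ := hS p q hpq
    refine ⟨hp, hq, hpq'.resolve_right fun h' => hq h'.2, fun x hpx hx hqx => ?_⟩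
    refine huniq x (Or.inl ⟨hpx, hpv, fun h' => hx (h' ▸ hvS)⟩) hx (hqx.mono ?_)
    exact fun a b hab ha hb => ⟨Or.inl ⟨hab, fun h' => ha (h' ▸ hvS), fun h' => hb (h' ▸ hvS)⟩,
      ha, hb⟩

/-- The forces are copied until one runs along the new edge; that one is subdivided through `v`, and
the rest is unchanged since `v` is then black. Such a force preserves colours, so `huw` shows that
`u` and `w` are not adjacent in `G`. -/
theorem PositiveForcing.exists_of_suppress {ι : Type*} {c : V → ι} (hu : G.Adj v u)
    (hw : G.Adj v w) (hN : ∀ x, G.Adj v x → x = u ∨ x = w) (hcu : c u = c v)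
    (huw : c u = c w → ¬ G.Adj u w) {S' : Set V} {L : List (V × V)}
    (h : (G.suppress v u w).PositiveForcing S' L Set.univ) (hS' : S' = insert v S) (hvS : v ∉ S)
    (hL : ∀ a b, (a, b) ∈ L → c a = c b) :
    ∃ L', G.PositiveForcing S L' Set.univ ∧ ∀ a b, (a, b) ∈ L' → c a = c b := by
  have huv : u ≠ v := (G.ne_of_adj hu).symm
  have hwv : w ≠ v := (G.ne_of_adj hw).symm
  have step : ∀ {u w : V} {S : Set V} {L : List (V × V)}, G.Adj v u → G.Adj v w →
      (∀ x, G.Adj v x → x = u ∨ x = w) → ¬ G.Adj u w → v ∉ S → c u = c v → c v = c w →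
      (∀ a b, (a, b) ∈ L → c a = c b) →
      (G.suppress v u w).PositiveForces (insert v S) u w →
      (G.suppress v u w).PositiveForcing (insert w (insert v S)) L Set.univ →
      ∃ L', G.PositiveForcing S L' Set.univ ∧ ∀ a b, (a, b) ∈ L' → c a = c b := by
    intro u w S L hu hw hN huw hvS hcu hcw hL h hr
    have huv : u ≠ v := (G.ne_of_adj hu).symm
    have hwv : w ≠ v := (G.ne_of_adj hw).symm
    obtain ⟨h1, h2⟩ := PositiveForces.subdivide_of_suppress hu hw hN hvS huw h
    refine ⟨(u, v) :: (v, w) :: L, .cons h1 (.cons h2 (hr.of_suppress_of_mem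
      (Or.inr (Or.inl rfl)) ?_)), ?_⟩
    · rintro x y (h' | ⟨-, ⟨rfl, rfl⟩ | ⟨rfl, rfl⟩⟩)
      · exact ⟨h'.2.1, h'.2.2, Or.inl h'.1⟩
      · exact ⟨huv, hwv, Or.inr ⟨Or.inr h.1, Or.inl rfl⟩⟩
      · exact ⟨hwv, huv, Or.inr ⟨Or.inl rfl, Or.inr h.1⟩⟩
    · intro a b hab
      rcases List.mem_cons.1 hab with h' | hab
      · obtain ⟨rfl, rfl⟩ := Prod.mk.inj h'; exact hcu
      rcases List.mem_cons.1 hab with h' | hab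
      · obtain ⟨rfl, rfl⟩ := Prod.mk.inj h'; exact hcw
      · exact hL a b hab
  induction L generalizing S S' with
  | nil =>
    cases h
    have hS : ∀ x ∉ S, x = v := fun x hx => by
      have : x ∈ insert v S := hS' ▸ Set.mem_univ x
      exact this.resolve_right hx
    -- No force used the new edge: everything except `v` is black, and `u` forces `v` last.
    refine ⟨[(u, v)], .cons (positiveForces_iff.2 ⟨?_, hvS, hu.symm, fun x _ hx _ => hS x hx⟩) ?_, ?_⟩
    · by_contra hu'
      exact huv (hS u hu')
    · rw [← hS']; exact .nil _
    · intro a b hab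
      obtain ⟨rfl, rfl⟩ := Prod.mk.inj (List.mem_singleton.1 hab)
      exact hcu
  | cons e L ih =>
    obtain ⟨p, q⟩ := e
    cases h with
    | cons h hr =>
    subst hS'
    have hL' : ∀ a b, (a, b) ∈ L → c a = c b := fun a b hab => hL a b (List.mem_cons_of_mem _ hab)
    have hpq : c p = c q := hL p q List.mem_cons_self
    by_cases h1 : p = u ∧ q = w
    · obtain ⟨rfl, rfl⟩ := h1
      exact step hu hw hN (huw hpq) hvS hcu (hcu.symm.trans hpq) hL' h hr
    by_cases h2 : p = w ∧ q = u
    · obtain ⟨rfl, rfl⟩ := h2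
      rw [suppress_comm] at h hr
      exact step hw hu (fun x hx => (hN x hx).symm) (fun h' => huw hpq.symm h'.symm) hvS
        (hpq.trans hcu) hcu.symm hL' h hr
    have hf := PositiveForces.of_suppress hu hw hN h h1 h2
    have hqv : q ≠ v := fun h' => (positiveForces_iff.1 h).2.1 (Or.inl h')
    obtain ⟨L', hL1, hL2⟩ := ih (S := insert q S) hr (Set.insert_comm _ _ _)
      (fun h' => h'.elim (fun h'' => hqv h''.symm) hvS) hL'
    refine ⟨(p, q) :: L', .cons hf hL1, fun a b hab => ?_⟩
    rcases List.mem_cons.1 hab with h' | hab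
    · obtain ⟨rfl, rfl⟩ := Prod.mk.inj h'; exact hpq
    · exact hL2 a b hab

end Lift

/-! ### Every covering by induced trees comes from a forcing process -/

/-- The edges of `G` with both ends of the same colour. -/
def monochromatic {ι : Type*} (G : SimpleGraph V) (c : V → ι) : SimpleGraph V where
  Adj x y := G.Adj x y ∧ c x = c y
  symm := ⟨fun _ _ h => ⟨h.1.symm, h.2.symm⟩⟩
  loopless := ⟨fun x h => G.loopless.irrefl x h.1⟩

/-- The edge `vu` is a bridge, and a path from `u` to `w` avoiding `v`, together with `vw`, would
bypass it. -/
theorem IsAcyclic.not_reachable {M H : SimpleGraph V} (hM : M.IsAcyclic) {u v w : V}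
    (hu : M.Adj v u) (hw : M.Adj v w) (huw : u ≠ w) (hle : ∀ x y, H.Adj x y → M.Adj x y ∧ x ≠ v ∧ y ≠ v) :
    ¬ H.Reachable u w := by
  intro hr
  have hb := isBridge_iff.1 (isAcyclic_iff_forall_adj_isBridge.1 hM hu)
  have hle' : H ≤ M \ fromEdgeSet {s(v, u)} := by
    intro x y hxy
    obtain ⟨h1, h2, h3⟩ := hle x y hxy
    refine ⟨h1, fun h' => ?_⟩
    have := (fromEdgeSet_adj _).1 h' |>.1
    rcases Sym2.eq_iff.1 this with h' | h'
    exacts [h2 h'.1, h3 h'.2]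
  have h1 : (M \ fromEdgeSet {s(v, u)}).Adj v w := by
    refine ⟨hw, fun h' => ?_⟩
    have := (fromEdgeSet_adj _).1 h' |>.1
    rcases Sym2.eq_iff.1 this with h' | h'
    exacts [huw h'.2.symm, M.ne_of_adj hu h'.1]
  exact hb (h1.reachable.trans (hr.mono hle').symm)

theorem IsAcyclic.not_adj_of_adj_of_adj {M : SimpleGraph V} (hM : M.IsAcyclic) {u v w : V}
    (hu : M.Adj v u) (hw : M.Adj v w) : ¬ M.Adj u w := by
  intro huw
  refine hM.not_reachable (H := edge u w) hu hw (M.ne_of_adj huw) (fun x y hxy => ?_) ?_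
  · rw [edge_adj] at hxy
    rcases hxy.1 with ⟨rfl, rfl⟩ | ⟨rfl, rfl⟩
    · exact ⟨huw, (M.ne_of_adj hu).symm, (M.ne_of_adj hw).symm⟩
    · exact ⟨huw.symm, (M.ne_of_adj hw).symm, (M.ne_of_adj hu).symm⟩
  · exact Adj.reachable (by rw [edge_adj]; exact ⟨Or.inl ⟨rfl, rfl⟩, M.ne_of_adj huw⟩)

theorem reachable_of_adj_imp {M H : SimpleGraph V} (f : V → V)
    (hf : ∀ x y, M.Adj x y → f x = f y ∨ H.Adj (f x) (f y)) {a b : V} (h : M.Reachable a b) :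
    H.Reachable (f a) (f b) := by
  obtain ⟨p⟩ := h
  induction p with
  | nil => exact .rfl
  | cons h _ ih =>
    rcases hf _ _ h with h' | h'
    · rw [h']; exact ih
    · exact h'.reachable.trans ih

theorem exists_positiveForcing_of_colouring [Finite V] {G : SimpleGraph V}
    (hG : ¬ ∃ a b X Y Z, G.IsK4Model a b X Y Z) {ι : Type u} (c : V → ι)
    (hac : (G.monochromatic c).IsAcyclic)
    (hconn : ∀ a b, c a = c b → (G.monochromatic c).Reachable a b) :
    ∃ (B : Set V) (L : List (V × V)), G.PositiveForcing B L Set.univ ∧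
      (∀ a b, (a, b) ∈ L → c a = c b) ∧ (∀ v, ∃ r ∈ B, c r = c v) ∧ Set.InjOn c B := by
  classical
  induction hn : G.support.ncard using Nat.strong_induction_on generalizing G ι with
  | _ n ih =>
  subst hn
  by_cases hE : ∃ x y, G.Adj x y
  swap
  · refine ⟨Set.univ, [], .nil _, by simp, fun v => ⟨v, trivial, rfl⟩, fun a _ b _ hab => ?_⟩
    obtain ⟨p⟩ := hconn a b hab
    cases p with
    | nil => rfl
    | cons h _ => exact absurd ⟨_, _, h.1⟩ hE
  obtain ⟨x₀, y₀, h₀⟩ := hE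
  obtain ⟨v, u, w, hu, hw, hN⟩ : ∃ v u w, G.Adj v u ∧ G.Adj v w ∧
      ∀ x, G.Adj v x → x = u ∨ x = w := by
    by_contra! hcon
    exact hG (exists_isK4Model_of_two_lt_degree h₀ hcon)
  have hsupp : ∀ {H : SimpleGraph V}, (∀ x y, H.Adj x y → x ≠ v ∧ x ∈ G.support) →
      H.support.ncard < G.support.ncard := by
    intro H hH
    refine Set.ncard_lt_ncard ?_
    refine ⟨fun x ⟨y, hxy⟩ => (hH x y hxy).2, fun h' => ?_⟩
    obtain ⟨y, hy⟩ := h' (show v ∈ G.support from ⟨u, hu⟩)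
    exact (hH v y hy).1 rfl
  by_cases hsing : ∀ x, c x = c v → x = v
  -- With equal ends no edge is added, so this suppression only isolates `v`.
  · have hle : ∀ x y, (G.suppress v v v).Adj x y → G.Adj x y ∧ x ≠ v ∧ y ≠ v := by
      rintro x y (h' | h')
      exacts [h', absurd rfl h'.1]
    have hac' : ((G.suppress v v v).monochromatic c).IsAcyclic := by
      refine hac.anti ?_
      rintro x y ⟨hxy, hcxy⟩
      exact ⟨(hle x y hxy).1, hcxy⟩
    obtain ⟨B, L, hBL, hL, hB, hinj⟩ := ih _ (hsupp (H := G.suppress v v v) fun x y hxy =>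
      ⟨(hle x y hxy).2.1, y, (hle x y hxy).1⟩)
      (fun ⟨a, b, X, Y, Z, h⟩ => hG ⟨a, b, X, Y, Z, h.mono fun x y hxy => (hle x y hxy).1⟩) c
      hac'
      (fun a b hab => (hconn a b hab).mono (G' := (G.suppress v v v).monochromatic c)
        fun x y (hxy : G.Adj x y ∧ c x = c y) => ⟨Or.inl ⟨hxy.1,
        fun h' => G.ne_of_adj hxy.1 (h'.trans (hsing y (h' ▸ hxy.2.symm)).symm),
        fun h' => G.ne_of_adj hxy.1 ((hsing x (h' ▸ hxy.2)).trans h'.symm)⟩, hxy.2⟩) rfl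
    refine ⟨B, L, hBL.of_suppress_of_mem ?_ fun x y hxy =>
      ⟨(hle x y hxy).2.1, (hle x y hxy).2.2, Or.inl (hle x y hxy).1⟩, hL, hB, hinj⟩
    obtain ⟨r, hr, hrv⟩ := hB v
    exact hsing r hrv ▸ hr
  · obtain ⟨u, w, hu, hw, hN, hcu⟩ : ∃ u w, G.Adj v u ∧ G.Adj v w ∧
        (∀ x, G.Adj v x → x = u ∨ x = w) ∧ c u = c v := by
      push Not at hsing
      obtain ⟨x, hx, hxv⟩ := hsing
      obtain ⟨p⟩ := hconn v x hx.symm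
      cases p with
      | nil => exact absurd rfl hxv
      | @cons _ z _ h _ =>
        rcases hN z h.1 with rfl | rfl
        · exact ⟨z, w, hu, hw, hN, h.2.symm⟩
        · exact ⟨z, u, hw, hu, fun x hx => (hN x hx).symm, h.2.symm⟩
    have huv : u ≠ v := (G.ne_of_adj hu).symm
    have hwv : w ≠ v := (G.ne_of_adj hw).symm
    -- The value `none` is a colour used by `v` alone.
    let c' : V → Option ι := fun x => if x = v then none else some (c x)
    have hc'v : c' v = none := if_pos rfl
    have hc' : ∀ {x}, x ≠ v → c' x = some (c x) := fun h => if_neg h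
    have hcc : ∀ {x y}, c' x = c' y → c x = c y := by
      intro x y hxy
      by_cases hx : x = v <;> by_cases hy : y = v
      · rw [hx, hy]
      · rw [hx, hc'v, hc' hy] at hxy; cases hxy
      · rw [hy, hc'v, hc' hx] at hxy; cases hxy
      · rw [hc' hx, hc' hy] at hxy; exact Option.some.inj hxy
    have huw : c u = c w → ¬ G.Adj u w := fun h h' =>
      hac.not_adj_of_adj_of_adj (M := G.monochromatic c) (u := u) (v := v) (w := w)
        ⟨hu, hcu.symm⟩ ⟨hw, hcu.symm.trans h⟩ ⟨h', h⟩
    have hacy : ((G.suppress v u w).monochromatic c').IsAcyclic := by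
      let M₀ : SimpleGraph V := (G.suppress v v v).monochromatic c
      have hM₀ : ∀ x y, M₀.Adj x y → (G.monochromatic c).Adj x y ∧ x ≠ v ∧ y ≠ v := by
        rintro x y ⟨h' | h', hc⟩
        exacts [⟨⟨h'.1, hc⟩, h'.2⟩, absurd rfl h'.1]
      have hM₀a : M₀.IsAcyclic := hac.anti fun x y hxy => (hM₀ x y hxy).1
      -- If the new edge is monochromatic, it joins two pieces of the tree that only `v` connected;
      -- otherwise edges are only lost.
      by_cases hcw : u ≠ w ∧ c u = c w
      · have hnr := hac.not_reachable (u := u) (v := v) (w := w)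
          ⟨hu, hcu.symm⟩ ⟨hw, hcu.symm.trans hcw.2⟩ hcw.1 hM₀
        refine (hM₀a.sup_edge_of_not_reachable hnr).anti ?_
        rintro x y ⟨h' | ⟨hne, h'⟩, hc⟩
        · exact Or.inl ⟨Or.inl h', hcc hc⟩
        · refine Or.inr ?_
          rw [edge_adj]
          refine ⟨h', ?_⟩
          rcases h' with ⟨rfl, rfl⟩ | ⟨rfl, rfl⟩
          exacts [hne, hne.symm]
      · refine hM₀a.anti ?_
        rintro x y ⟨h' | ⟨hne, ⟨rfl, rfl⟩ | ⟨rfl, rfl⟩⟩, hc⟩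
        · exact ⟨Or.inl h', hcc hc⟩
        · exact absurd ⟨hne, hcc hc⟩ hcw
        · exact absurd ⟨hne, (hcc hc).symm⟩ hcw
    have hcon' : ∀ a b, c' a = c' b → ((G.suppress v u w).monochromatic c').Reachable a b := by
      intro a b hab
      by_cases ha : a = v <;> by_cases hb : b = v
      · rw [ha, hb]
      · rw [ha, hc'v, hc' hb] at hab; cases hab
      · rw [hb, hc'v, hc' ha] at hab; cases hab
      -- Sending `v` to `u` carries monochromatic walks of `G` to monochromatic walks of the
      -- suppressed graph.
      · have := reachable_of_adj_imp (H := (G.suppress v u w).monochromatic c')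
          (fun x => if x = v then u else x) ?_ (hconn a b (hcc hab))
        · simpa only [if_neg ha, if_neg hb] using this
        have hv : ∀ y, (G.monochromatic c).Adj v y →
            u = y ∨ ((G.suppress v u w).monochromatic c').Adj u y := by
          intro y hy
          by_cases huy : u = y
          · exact Or.inl huy
          · obtain rfl := (hN y hy.1).resolve_left (Ne.symm huy)
            refine Or.inr ⟨Or.inr ⟨huy, Or.inl ⟨rfl, rfl⟩⟩, ?_⟩
            rw [hc' huv, hc' hwv, hcu, hy.2]
        intro x y hxy
        by_cases hx : x = v <;> by_cases hy : y = v
        · exact Or.inl (by rw [hx, hy])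
        · subst hx
          simp only [if_neg hy, if_true]
          exact hv y hxy
        · subst hy
          simp only [if_neg hx, if_true]
          exact (hv x hxy.symm).imp Eq.symm fun h => h.symm
        · simp only [if_neg hx, if_neg hy]
          exact Or.inr ⟨Or.inl ⟨hxy.1, hx, hy⟩, by rw [hc' hx, hc' hy, hxy.2]⟩
    obtain ⟨B, L, hBL, hL, hB, hinj⟩ := ih _ (hsupp (H := G.suppress v u w) (by
      rintro x y (h' | ⟨-, ⟨rfl, rfl⟩ | ⟨rfl, rfl⟩⟩)
      exacts [⟨h'.2.1, y, h'.1⟩, ⟨huv, v, hu.symm⟩, ⟨hwv, v, hw.symm⟩]))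
      (fun ⟨a, b, X, Y, Z, h⟩ => hG (h.exists_of_suppress hu hw)) c' hacy hcon' rfl
    have hvB : v ∈ B := by
      obtain ⟨r, hr, hrv⟩ := hB v
      by_cases h : r = v
      · exact h ▸ hr
      · rw [hc'v, hc' h] at hrv; cases hrv
    -- The initial vertex `v` is dropped: under `c` its class is that of `u`, which has another
    -- initial vertex.
    obtain ⟨L', hL1, hL2⟩ := hBL.exists_of_suppress (S := B \ {v}) hu hw hN hcu huw
      (by rw [Set.insert_sdiff_singleton, Set.insert_eq_of_mem hvB]) (by simp)
      fun a b hab => hcc (hL a b hab)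
    refine ⟨B \ {v}, L', hL1, hL2, ?_, ?_⟩
    · have key : ∀ x, x ≠ v → ∃ r ∈ B \ {v}, c r = c x := by
        intro x hx
        obtain ⟨r, hr, hrx⟩ := hB x
        refine ⟨r, ⟨hr, ?_⟩, hcc hrx⟩
        rintro rfl
        rw [hc'v, hc' hx] at hrx; cases hrx
      intro x
      by_cases hx : x = v
      · rw [hx, ← hcu]; exact key u huv
      · exact key x hx
    · intro a ha b hb hab
      exact hinj ha.1 hb.1 (by rw [hc' ha.2, hc' hb.2, hab])

/-! ### Forcing trees -/

namespace PositiveForcing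

variable {G : SimpleGraph V} {B C : Set V} {L : List (V × V)}

/-- Each forced vertex is to inherit the colour of its root. By induction from the end of the list,
the class that the remaining process roots at `q` is merged into that of `p`. -/
theorem exists_colouring (h : G.PositiveForcing B L C) :
    ∃ c : V → V, (∀ r ∈ B, c r = r) ∧ ∀ a b, (a, b) ∈ L → c a = c b := by
  classical
  induction h with
  | nil B => exact ⟨id, fun _ _ => rfl, by simp⟩
  | @cons B C p q L h _ ih =>
    obtain ⟨c, hc, hL⟩ := ih
    obtain ⟨hp, hq, -⟩ := positiveForces_iff.1 h
    have hcB : ∀ r ∈ B, (if c r = q then p else c r) = r := fun r hr => by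
      have := hc r (Or.inr hr)
      rw [this, if_neg fun h' : r = q => hq (h' ▸ hr)]
    refine ⟨fun x => if c x = q then p else c x, hcB, fun a b hab => ?_⟩
    rcases List.mem_cons.1 hab with h' | hab
    · obtain ⟨rfl, rfl⟩ := Prod.mk.inj h'
      simp only
      rw [hcB a hp, if_pos (hc b (Or.inl rfl))]
    · simp only [hL a b hab]

theorem adj_of_mem (h : G.PositiveForcing B L C) {a b : V} (hab : (a, b) ∈ L) : G.Adj a b := by
  induction h with
  | nil B => cases hab
  | cons h _ ih =>
    rcases List.mem_cons.1 hab with h' | hab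
    · obtain ⟨rfl, rfl⟩ := Prod.mk.inj h'
      exact (positiveForces_iff.1 h).2.2.1
    · exact ih hab

theorem exists_root (h : G.PositiveForcing B L C) {v : V} (hv : v ∈ C) :
    ∃ r ∈ B, Relation.ReflTransGen (fun a b => (a, b) ∈ L) r v := by
  induction h with
  | nil B => exact ⟨v, hv, .refl⟩
  | @cons B C p q L h _ ih =>
    obtain ⟨r, hr, hrv⟩ := ih hv
    have hrv' : Relation.ReflTransGen (fun a b => (a, b) ∈ (p, q) :: L) r v :=
      hrv.lift id fun a b hab => List.mem_cons_of_mem _ hab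
    rcases hr with rfl | hr
    · exact ⟨p, h.1, .head List.mem_cons_self hrv'⟩
    · exact ⟨r, hr, hrv'⟩

/-- Forces are added from the last to the first. Both `p` and `q` are initial for the remaining
process, hence in different classes, so the edge `pq` closes no cycle. -/
theorem isAcyclic_fromRel (h : G.PositiveForcing B L C) :
    (fromRel fun a b => (a, b) ∈ L).IsAcyclic := by
  induction h with
  | nil B => exact isAcyclic_bot.anti fun x y h => by simp at h
  | @cons B C p q L h hL ih =>
    obtain ⟨c, hc, hcL⟩ := hL.exists_colouring
    obtain ⟨hp, hq, -⟩ := positiveForces_iff.1 h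
    have hnr : ¬ (fromRel fun a b => (a, b) ∈ L).Reachable p q := by
      rintro ⟨w⟩
      have key : ∀ {x y} (w : (fromRel fun a b => (a, b) ∈ L).Walk x y), c x = c y := by
        intro x y w
        induction w with
        | nil => rfl
        | cons h _ ih =>
          refine Eq.trans ?_ ih
          rcases ((fromRel_adj _ _ _).1 h).2 with h' | h'
          exacts [hcL _ _ h', (hcL _ _ h').symm]
      have := key w
      rw [hc p (Or.inr hp), hc q (Or.inl rfl)] at this
      exact hq (this ▸ hp)
    refine (ih.sup_edge_of_not_reachable hnr).anti fun x y hxy => ?_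
    rw [fromRel_adj] at hxy
    obtain ⟨hne, hxy⟩ := hxy
    simp only [sup_adj, fromRel_adj, edge_adj]
    rcases hxy with hxy | hxy <;> rcases List.mem_cons.1 hxy with h' | h'
    · obtain ⟨rfl, rfl⟩ := Prod.mk.inj h'
      exact Or.inr ⟨Or.inl ⟨rfl, rfl⟩, hne⟩
    · exact Or.inl ⟨hne, Or.inl h'⟩
    · obtain ⟨rfl, rfl⟩ := Prod.mk.inj h'
      exact Or.inr ⟨Or.inr ⟨rfl, rfl⟩, hne⟩
    · exact Or.inl ⟨hne, Or.inr h'⟩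

/-- In a forcing process whose initial vertices have different colours and whose forces preserve
colours, adjacent vertices of the same colour are linked by a force. -/
theorem mem_of_adj {ι : Type*} {c : V → ι} (h : G.PositiveForcing B L C)
    (hL : ∀ a b, (a, b) ∈ L → c a = c b) (hB : Set.InjOn c B) {a b : V} (ha : a ∈ C) (hb : b ∈ C)
    (hab : G.Adj a b) (hc : c a = c b) : (a, b) ∈ L ∨ (b, a) ∈ L := by
  -- The hypothesis is the invariant: black vertices of one colour with neighbours in a common white
  -- component are equal. When the later of `a`, `b` turns black, the earlier one and the forcing
  -- vertex are both adjacent to it, so they coincide.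
  suffices H : (∀ x ∈ B, ∀ y ∈ B, c x = c y → ∀ x' y', x' ∉ B → y' ∉ B → G.Adj x x' →
      G.Adj y y' → G.WhiteReach B x' y' → x = y) → ¬ (a ∈ B ∧ b ∈ B) → (a, b) ∈ L ∨ (b, a) ∈ L from
    H (fun x hx y hy hxy _ _ _ _ _ _ _ => hB hx hy hxy)
      fun h' => G.ne_of_adj hab (hB h'.1 h'.2 hc)
  clear hB
  induction h with
  | nil B => exact fun _ h' => absurd ⟨ha, hb⟩ h'
  | @cons B C p q L h _ ih =>
    intro hinv hnot
    obtain ⟨hp, hq, hpq, huniq⟩ := positiveForces_iff.1 h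
    have hcpq : c p = c q := hL p q List.mem_cons_self
    have hbq : ∀ y ∈ B, c y = c q → G.Adj y q → y = p := fun y hy hyq hadj =>
      hinv y hy p hp (hyq.trans hcpq.symm) q q hq hq hadj hpq .refl
    by_cases hnot' : a ∈ insert q B ∧ b ∈ insert q B
    · rcases hnot' with ⟨rfl | haB, rfl | hbB⟩
      · exact absurd hab (G.loopless.irrefl _)
      · exact Or.inr (hbq b hbB hc.symm hab.symm ▸ List.mem_cons_self)
      · exact Or.inl (hbq a haB hc hab ▸ List.mem_cons_self)
      · exact absurd ⟨haB, hbB⟩ hnot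
    -- The invariant persists when `q` turns black: its white neighbours were in its own component,
    -- so a conflicting `y` equals `p`, and `p` had no neighbour there besides `q`.
    have hnew : ∀ y ∈ B, c q = c y → ∀ x' y', x' ∉ insert q B → y' ∉ insert q B → G.Adj q x' →
        G.Adj y y' → G.WhiteReach B x' y' → False := by
      intro y hy hqy x' y' hx' hy' hqx hyy hr
      have hx'B : x' ∉ B := fun h' => hx' (Or.inr h')
      have hy'B : y' ∉ B := fun h' => hy' (Or.inr h')
      have hr' : G.WhiteReach B q y' := .head ⟨hqx, hq, hx'B⟩ hr
      obtain rfl := hinv y hy p hp (hqy.symm.trans hcpq.symm) y' q hy'B hq hyy hpq hr'.symm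
      exact hy' (Or.inl (huniq y' hyy hy'B hr'))
    refine (ih (fun a b hab => hL a b (List.mem_cons_of_mem _ hab)) ha hb ?_ hnot').imp
      (List.mem_cons_of_mem _) (List.mem_cons_of_mem _)
    intro x hx y hy hxy x' y' hx' hy' hxx hyy hr
    have hr' : G.WhiteReach B x' y' := hr.mono fun s t hst hs ht =>
      ⟨hst, fun h' => hs (Or.inr h'), fun h' => ht (Or.inr h')⟩
    rcases hx with rfl | hx <;> rcases hy with rfl | hy
    · rfl
    · exact (hnew y hy hxy x' y' hx' hy' hxx hyy hr').elim
    · exact (hnew x hx hxy.symm y' x' hy' hx' hyy hxx hr'.symm).elim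
    · exact hinv x hx y hy hxy x' y' (fun h' => hx' (Or.inr h')) (fun h' => hy' (Or.inr h'))
        hxx hyy hr'

theorem reach_iff {ι : Type*} {c : V → ι} (h : G.PositiveForcing B L Set.univ)
    (hL : ∀ a b, (a, b) ∈ L → c a = c b) (hB : Set.InjOn c B) {r v : V} (hr : r ∈ B) :
    Relation.ReflTransGen (fun a b => (a, b) ∈ L) r v ↔ c v = c r := by
  have key : ∀ {r}, Relation.ReflTransGen (fun a b => (a, b) ∈ L) r v → c v = c r := by
    intro r hrv
    induction hrv with
    | refl => rfl
    | tail _ hbc ih => exact (hL _ _ hbc).symm.trans ih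
  refine ⟨key, fun hv => ?_⟩
  obtain ⟨s, hs, hsv⟩ := h.exists_root (Set.mem_univ v)
  exact hB hs hr ((key hsv).symm.trans hv) ▸ hsv

/-- The colour of a vertex is its root, so the trees are the colour classes; `mem_of_adj` makes them
induced, and distinct roots give distinct trees. -/
theorem isTreeCovering (h : G.PositiveForcing B L Set.univ) :
    G.IsTreeCovering {H | ∃ r ∈ B, H = G.forcingTree L r} ∧
      {H | ∃ r ∈ B, H = G.forcingTree L r}.ncard = B.ncard := by
  obtain ⟨c, hcB, hL⟩ := h.exists_colouring
  have hinj : Set.InjOn c B := fun r hr s hs hrs => by rwa [hcB r hr, hcB s hs] at hrs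
  refine ⟨⟨?_, ?_, ?_, ?_⟩, ?_⟩
  · rintro _ ⟨r, hr, rfl⟩ a ha b hb hab
    exact ⟨ha, hb, hab, h.mem_of_adj hL hinj trivial trivial hab
      (((h.reach_iff hL hinj hr).1 ha).trans ((h.reach_iff hL hinj hr).1 hb).symm)⟩
  · rintro _ ⟨r, hr, rfl⟩
    let root : (G.forcingTree L r).verts := ⟨r, .refl⟩
    have hreach : ∀ x : (G.forcingTree L r).verts, (G.forcingTree L r).coe.Reachable root x := by
      rintro ⟨x, hx⟩
      have key : ∀ x, ∀ hx : Relation.ReflTransGen (fun a b => (a, b) ∈ L) r x,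
          (G.forcingTree L r).coe.Reachable root ⟨x, hx⟩ := by
        intro x hx
        induction hx with
        | refl => exact .rfl
        | @tail b d hrb hbd ih =>
          exact ih.trans (Adj.reachable ⟨hrb, hrb.tail hbd, h.adj_of_mem hbd, Or.inl hbd⟩)
      exact key x hx
    have hne : Nonempty (G.forcingTree L r).verts := ⟨root⟩
    refine ⟨⟨fun x y => (hreach x).symm.trans (hreach y)⟩, ?_⟩
    exact h.isAcyclic_fromRel.comap
      (⟨fun x => x.1, fun {a b} hab => (fromRel_adj _ _ _).2
        ⟨G.ne_of_adj hab.2.2.1, hab.2.2.2⟩⟩ : (G.forcingTree L r).coe →g _) Subtype.val_injective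
  · rintro _ ⟨r, hr, rfl⟩ _ ⟨s, hs, rfl⟩ hne
    refine Set.disjoint_left.2 fun v hv hv' => hne ?_
    have := ((h.reach_iff hL hinj hr).1 hv).symm.trans ((h.reach_iff hL hinj hs).1 hv')
    rw [hinj hr hs this]
  · refine Set.eq_univ_of_forall fun v => ?_
    obtain ⟨r, hr, hrv⟩ := h.exists_root (Set.mem_univ v)
    exact Set.mem_biUnion (s := {H | ∃ r ∈ B, H = G.forcingTree L r}) ⟨r, hr, rfl⟩ hrv
  · have : {H | ∃ r ∈ B, H = G.forcingTree L r} = (fun r => G.forcingTree L r) '' B := by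
      ext H
      simp only [Set.mem_ofPred_eq, Set.mem_image, eq_comm (a := H)]
    rw [this, Set.InjOn.ncard_image]
    intro r hr s hs hrs
    have hv : r ∈ (G.forcingTree L s).verts := by
      have : r ∈ (G.forcingTree L r).verts := Relation.ReflTransGen.refl
      rwa [show G.forcingTree L r = G.forcingTree L s from hrs] at this
    exact hinj hr hs ((h.reach_iff hL hinj hs).1 hv)

end PositiveForcing

/-- Colour each vertex by the tree containing it. A process that preserves these colours and has one
initial vertex per colour can only have the given trees as forcing trees, because both families are
induced on the colour classes. -/
theorem IsTreeCovering.exists_positiveForcing [Finite V] {G : SimpleGraph V}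
    (hG : ¬ ∃ a b X Y Z, G.IsK4Model a b X Y Z) {T : Set G.Subgraph} (hT : G.IsTreeCovering T) :
    ∃ (B : Set V) (L : List (V × V)), G.PositiveForcing B L Set.univ ∧
      T = {H | ∃ r ∈ B, H = G.forcingTree L r} := by
  have hex : ∀ v, ∃ H ∈ T, v ∈ H.verts := fun v => by
    have : v ∈ ⋃ H ∈ T, H.verts := hT.cover ▸ Set.mem_univ v
    simpa using this
  choose c hcT hvc using hex
  have hc : ∀ {H v}, H ∈ T → v ∈ H.verts → c v = H := fun {H v} hH hv => by
    by_contra hne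
    exact Set.disjoint_left.1 (hT.disjoint (hcT v) hH hne) (hvc v) hv
  have hac : (G.monochromatic c).IsAcyclic := by
    rw [isAcyclic_iff_forall_adj_isBridge]
    intro v w hvw
    rw [isBridge_iff]
    intro hr
    have hv := hvc v
    have hw : w ∈ (c v).verts := hvw.2 ▸ hvc w
    have hadj : (c v).coe.Adj ⟨v, hv⟩ ⟨w, hw⟩ := hT.isInduced _ (hcT v) hv hw hvw.1
    refine isBridge_iff.1 (isAcyclic_iff_forall_adj_isBridge.1 (hT.isTree _ (hcT v)).2 hadj) ?_
    rw [reachable_iff_reflTransGen] at hr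
    -- A monochromatic walk from `v` stays in the tree `c v`, so a detour around the edge `vw` would
    -- be a detour within that tree.
    have key : ∀ x, Relation.ReflTransGen (G.monochromatic c \ fromEdgeSet {s(v, w)}).Adj v x →
        ∃ hx : x ∈ (c v).verts,
          ((c v).coe \ fromEdgeSet {s((⟨v, hv⟩ : (c v).verts), ⟨w, hw⟩)}).Reachable ⟨v, hv⟩ ⟨x, hx⟩ := by
      intro x hx
      induction hx with
      | refl => exact ⟨hv, .rfl⟩
      | @tail y z _ hyz ih =>
        obtain ⟨hy, hry⟩ := ih
        have hz : z ∈ (c v).verts := by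
          have h1 : c y = c v := hc (hcT v) hy
          have h2 : c y = c z := hyz.1.2
          exact (h2.symm.trans h1) ▸ hvc z
        refine ⟨hz, hry.trans (Adj.reachable ⟨hT.isInduced _ (hcT v) hy hz hyz.1.1, fun h' => ?_⟩)⟩
        refine hyz.2 ((fromEdgeSet_adj _).2 ⟨?_, G.ne_of_adj hyz.1.1⟩)
        have := ((fromEdgeSet_adj _).1 h').1
        have := congrArg (Sym2.map Subtype.val) this
        simpa using this
    exact (key w hr).2
  have hconn : ∀ a b, c a = c b → (G.monochromatic c).Reachable a b := by
    intro a b hab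
    have hb : b ∈ (c a).verts := hab ▸ hvc b
    have := (hT.isTree _ (hcT a)).1.preconnected ⟨a, hvc a⟩ ⟨b, hb⟩
    exact this.map (⟨fun x => x.1, fun {x y} hxy => ⟨hxy.adj_sub,
      (hc (hcT a) x.2).trans (hc (hcT a) y.2).symm⟩⟩ : (c a).coe →g G.monochromatic c)
  obtain ⟨B, L, hBL, hL, hB, hinj⟩ := exists_positiveForcing_of_colouring hG c hac hconn
  have heq : ∀ r ∈ B, c r = G.forcingTree L r := by
    intro r hr
    have hverts : ∀ v, v ∈ (c r).verts ↔ Relation.ReflTransGen (fun a b => (a, b) ∈ L) r v := by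
      intro v
      rw [hBL.reach_iff hL hinj hr]
      exact ⟨fun hv => hc (hcT r) hv, fun hv => hv ▸ hvc v⟩
    ext a b
    · exact hverts a
    · constructor
      · intro hab
        have ha := (c r).edge_vert hab
        have hb := (c r).edge_vert hab.symm
        exact ⟨(hverts a).1 ha, (hverts b).1 hb, hab.adj_sub, hBL.mem_of_adj hL hinj trivial trivial
          hab.adj_sub ((hc (hcT r) ha).trans (hc (hcT r) hb).symm)⟩
      · rintro ⟨ha, hb, hab, -⟩
        exact hT.isInduced _ (hcT r) ((hverts a).2 ha) ((hverts b).2 hb) hab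
  refine ⟨B, L, hBL, ?_⟩
  ext H
  constructor
  · intro hH
    obtain ⟨⟨v, hv⟩⟩ := (hT.isTree H hH).1.nonempty
    obtain ⟨r, hr, hrv⟩ := hB v
    exact ⟨r, hr, by rw [← heq r hr, hrv, hc hH hv]⟩
  · rintro ⟨r, hr, rfl⟩
    exact heq r hr ▸ hcT r

end SimpleGraph

/-! ### The equality of the two numbers and the description of minimum tree coverings -/

open SimpleGraph in
theorem theorem8p3 {V : Type*} [Finite V] (G : SimpleGraph V) (hG : G.IsOuterplanar) :
    G.positiveZeroForcingNumber = G.treeCoverNumber ∧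
    ∀ T : Set G.Subgraph, G.IsTreeCovering T → T.ncard = G.treeCoverNumber →
      ∃ (B : Set V) (L : List (V × V)),
        G.PositiveForcing B L Set.univ ∧ B.ncard = G.positiveZeroForcingNumber ∧
        T.ncard = G.positiveZeroForcingNumber ∧
        T = {H | ∃ r ∈ B, H = G.forcingTree L r} := by
  have hK : ¬ ∃ a b X Y Z, G.IsK4Model a b X Y Z := fun ⟨_, _, _, _, _, h⟩ => hG.not_isK4Model h
  have hcov : ∀ T : Set G.Subgraph, G.IsTreeCovering T → ∃ (B : Set V) (L : List (V × V)),
      G.PositiveForcing B L Set.univ ∧ B.ncard = T.ncard ∧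
        T = {H | ∃ r ∈ B, H = G.forcingTree L r} := by
    intro T hT
    obtain ⟨B, L, hBL, rfl⟩ := hT.exists_positiveForcing hK
    exact ⟨B, L, hBL, hBL.isTreeCovering.2.symm, rfl⟩
  have hne : {k | ∃ B : Set V, G.IsPositiveZeroForcingSet B ∧ B.ncard = k}.Nonempty :=
    ⟨_, Set.univ, ⟨[], .nil _⟩, rfl⟩
  have hle : G.treeCoverNumber ≤ G.positiveZeroForcingNumber := by
    obtain ⟨B, ⟨L, hBL⟩, hB⟩ := Nat.sInf_mem hne
    exact Nat.sInf_le ⟨_, hBL.isTreeCovering.1, hBL.isTreeCovering.2.trans hB⟩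
  have hne' : {k | ∃ T : Set G.Subgraph, G.IsTreeCovering T ∧ T.ncard = k}.Nonempty := by
    obtain ⟨_, B, ⟨L, hBL⟩, -⟩ := hne
    exact ⟨_, _, hBL.isTreeCovering.1, rfl⟩
  have heq : G.positiveZeroForcingNumber = G.treeCoverNumber := by
    refine le_antisymm ?_ hle
    obtain ⟨T, hT, hTk⟩ := Nat.sInf_mem hne'
    obtain ⟨B, L, hBL, hB, -⟩ := hcov T hT
    exact Nat.sInf_le ⟨B, ⟨L, hBL⟩, hB.trans hTk⟩
  refine ⟨heq, fun T hT hTk => ?_⟩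
  obtain ⟨B, L, hBL, hB, hTB⟩ := hcov T hT
  exact ⟨B, L, hBL, by rw [hB, hTk, heq], by rw [hTk, heq], hTB⟩
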